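/- Let $p$ be a prime. For $h\in\mathbb{N}$ call a subset of $\mathbb{Q}_p$ \emph{uniformly measurable of radius $h$} if it is a union of cosets of $p^h\mathbb{Z}_p$, and \emph{uniformly measurable} if it is so of some radius $h\in\mathbb{N}$. Let $\mathscr{D}=\mathscr{D}_{\rm unif}(\mathbb{Q}_p,\mathbb{Z}_p)$ be the set of $\mathbb{Z}_p$-valued functions $\mu$ on the uniformly measurable sets such that, for every $h$ and every disjoint family $(U_\alpha)_\alpha$ of uniformly measurable sets of radius $h$, the series $\sum_\alpha\mu(U_\alpha)$ converges unconditionally to $\mu(\bigcup_\alpha U_\alpha)$. It is a commutative $\mathbb{Z}_p$-algebra under convolution, with unit the Dirac mass $\Delta_0$, and it carries its natural topology of uniform convergence on the uniformly measurable sets of the same radius (a basis of neighbourhoods of $0$ is given by the sets $\{\mu : \mu(U)\in p^{\ell}\mathbb{Z}_p \text{ for all } U \text{ of radius } h\}$, $h,\ell\in\mathbb{N}$). Put $S=\mathbb{Z}[1/p]\cap\mathbb{R}_{\ge 0}$, let $v$ be the $p$-adic valuation ($v(0)=\infty$), let $T_n=\Delta_{1/p^n}-\Delta_0$ and $\widetilde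 T_n=\lim_{m\to\infty}T_{n+m}^{p^m}$; these limits exist in the $p$-adic topology of $\mathscr{D}$. With $\widetilde T=\widetilde T_0$, the definition $\widetilde T^{m/p^n}:=\widetilde T_n^{\,m}$ is unambiguous for $m/p^n\in S$. Let $\mathbb{Z}[\widetilde T^{1/p^\infty}]$ be the subring of $\mathscr{D}$ generated by all $\widetilde T_n$. Then: 1. Every element of $\mathbb{Z}[\widetilde T^{1/p^\infty}]$ is a unique finite sum $\sum_{q\in S}a_q\widetilde T^q$ with $a_q\in\mathbb{Z}$, the formula $w(\sum_q a_q\widetilde T^q)=\min_{q\in S}(v(a_q)+q)$ defines a valuation on this ring, and the topological ring $\mathscr{D}$ is its $w$-completion: $\mathscr{D}$ is separated and complete, $\mathbb{Z}[\widetilde T^{1/p^\infty}]$ is dense in $\mathscr{D}$, and the uniformity of $\mathscr{D}$ induces on it the one defined by $w$. 2. Every element of $\mathscr{D}$ is the sum of a unique $S$-series $\sum_{q\in S}a_q\widetilde T^q$ with $a_q\in\mathbb{Z}_p$ such that, for every $C>0$, $v(a_q)+q>C$ for all but finitely many $q\in S$. Conversely, every $S$-series with this property converges unconditionally in $\mathscr{D}$.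 3. The formula $w(\sum_{q\in S}a_q\widetilde T^q)=\min_{q\in S}(v(a_q)+q)$ (for the series in 2) defines a valuation on $\mathscr{D}$, with values in $S\cup\{\infty\}$, and the topology that it induces coincides with the $(p,\widetilde T)$-adic topology of $\mathscr{D}$ and with its natural topology. -/

import Mathlib

noncomputable section

open Filter Topology Set

namespace PadicMeasures

variable (p : ℕ) [Fact p.Prime]

/-- The subgroup `p ^ h ℤ_p` of `ℚ_p`. -/
def ballSubgroup (h : ℕ) : AddSubgroup ℚ_[p] where
  carrier := {x | ‖x‖ ≤ (p : ℝ) ^ (-(h : ℤ))}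
  zero_mem' := by simp
  add_mem' := fun {a b} ha hb => (IsUltrametricDist.norm_add_le_max a b).trans (max_le ha hb)
  neg_mem' := fun {a} ha => by simpa using ha

/-- The discrete quotient group `ℚ_p / p ^ h ℤ_p`, whose points are the balls of radius `h`. -/
abbrev Balls (h : ℕ) : Type := ℚ_[p] ⧸ ballSubgroup p h

/-- The quotient map `π_h : ℚ_p → ℚ_p / p ^ h ℤ_p`. -/
def proj (h : ℕ) (x : ℚ_[p]) : Balls p h := QuotientAddGroup.mk x

/-- The uniformly measurable subsets of radius `h`: arbitrary unions of cosets of `p ^ h ℤ_p`. -/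
def unifSetsOfRadius (h : ℕ) : Set (Set ℚ_[p]) :=
  {U | ∃ V : Set (Balls p h), U = proj p h ⁻¹' V}

/-- The uniformly measurable subsets of `ℚ_p`. -/
def unifSets : Set (Set ℚ_[p]) := ⋃ h : ℕ, unifSetsOfRadius p h

variable {p}

theorem proj_surjective (h : ℕ) : Function.Surjective (proj p h) :=
  Quotient.mk_surjective

theorem mem_unifSets {h : ℕ} {U : Set ℚ_[p]} (hU : U ∈ unifSetsOfRadius p h) : U ∈ unifSets p :=
  mem_iUnion.2 ⟨h, hU⟩

theorem iUnion_mem {h : ℕ} {ι : Type} {U : ι → Set ℚ_[p]} (hU : ∀ i, U i ∈ unifSetsOfRadius p h) :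
    (⋃ i, U i) ∈ unifSetsOfRadius p h := by
  choose V hV using hU
  exact ⟨⋃ i, V i, by rw [preimage_iUnion]; exact iUnion_congr hV⟩

variable (p)

/-- The uniform `ℤ_p`-valued measures on `ℚ_p`: functions `μ` on the uniformly measurable sets such
that for every disjoint family of uniformly measurable sets of one and the same radius the family of
the measures is unconditionally summable, with sum the measure of the union. -/
@[ext]
structure UnifMeasure where
  /-- The underlying set function. -/
  toFun : unifSets p → ℤ_[p]
  hasSum_iUnion : ∀ (h : ℕ) (ι : Type) (U : ι → Set ℚ_[p]) (hU : ∀ i, U i ∈ unifSetsOfRadius p h),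
    Pairwise (fun i j => Disjoint (U i) (U j)) →
      HasSum (fun i => toFun ⟨U i, mem_unifSets (hU i)⟩)
        (toFun ⟨⋃ i, U i, mem_unifSets (iUnion_mem hU)⟩)

variable {p}

namespace UnifMeasure

/-- The set `π_h⁻¹(V)` as a uniformly measurable set. -/
def cyl (h : ℕ) (V : Set (Balls p h)) : unifSets p := ⟨proj p h ⁻¹' V, mem_unifSets ⟨V, rfl⟩⟩

/-- The measure of a ball of radius `h`. -/
def ball (μ : UnifMeasure p) (h : ℕ) (c : Balls p h) : ℤ_[p] := μ.toFun (cyl h {c})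

/-- The group operations on measures are those of their values. -/
instance : Zero (UnifMeasure p) := ⟨⟨0, fun _ _ _ _ _ => hasSum_zero⟩⟩

instance : Add (UnifMeasure p) :=
  ⟨fun μ ν => ⟨μ.toFun + ν.toFun, fun h ι U hU hd =>
    (μ.hasSum_iUnion h ι U hU hd).add (ν.hasSum_iUnion h ι U hU hd)⟩⟩

instance : Neg (UnifMeasure p) :=
  ⟨fun μ => ⟨-μ.toFun, fun h ι U hU hd => (μ.hasSum_iUnion h ι U hU hd).neg⟩⟩

instance : Sub (UnifMeasure p) :=
  ⟨fun μ ν => ⟨μ.toFun - ν.toFun, fun h ι U hU hd =>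
    (μ.hasSum_iUnion h ι U hU hd).sub (ν.hasSum_iUnion h ι U hU hd)⟩⟩

instance : SMul ℤ_[p] (UnifMeasure p) :=
  ⟨fun a μ => ⟨a • μ.toFun, fun h ι U hU hd => (μ.hasSum_iUnion h ι U hU hd).mul_left a⟩⟩

instance : SMul ℕ (UnifMeasure p) :=
  ⟨fun a μ => ⟨a • μ.toFun, fun h ι U hU hd => (μ.hasSum_iUnion h ι U hU hd).const_smul a⟩⟩

instance : SMul ℤ (UnifMeasure p) :=
  ⟨fun a μ => ⟨a • μ.toFun, fun h ι U hU hd => (μ.hasSum_iUnion h ι U hU hd).const_smul a⟩⟩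

theorem toFun_injective : Function.Injective (toFun : UnifMeasure p → unifSets p → ℤ_[p]) :=
  fun _ _ h => UnifMeasure.ext h

instance : AddCommGroup (UnifMeasure p) :=
  toFun_injective.addCommGroup _ rfl (fun _ _ => rfl) (fun _ => rfl) (fun _ _ => rfl)
    (fun _ _ => rfl) (fun _ _ => rfl)

/-- The additive homomorphism underlying `toFun`. -/
def toFunHom : UnifMeasure p →+ (unifSets p → ℤ_[p]) where
  toFun := toFun
  map_zero' := rfl
  map_add' _ _ := rfl

instance : Module ℤ_[p] (UnifMeasure p) :=
  toFun_injective.module ℤ_[p] toFunHom (fun _ _ => rfl)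

open Classical in
/-- The Dirac mass at `x`. -/
def dirac (x : ℚ_[p]) : UnifMeasure p where
  toFun U := if x ∈ U.1 then 1 else 0
  hasSum_iUnion h ι U hU hd := by
    by_cases hx : ∃ i, x ∈ U i
    · obtain ⟨i, hi⟩ := hx
      have h1 : x ∈ ⋃ i, U i := mem_iUnion.2 ⟨i, hi⟩
      simp only [h1, if_true]
      have := hasSum_single (f := fun j => if x ∈ U j then (1 : ℤ_[p]) else 0) i (fun j hj => by
        have : x ∉ U j := fun hxj => (disjoint_left.1 (hd hj)) hxj hi
        simp [this])
      simpa [hi] using this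
    · have h1 : x ∉ ⋃ i, U i := fun h => hx (mem_iUnion.1 h)
      have h2 : ∀ i, x ∉ U i := fun i h => hx ⟨i, h⟩
      simp only [h1, h2, if_false]
      exact hasSum_zero

theorem hasSum_cyl (μ : UnifMeasure p) (h : ℕ) (V : Set (Balls p h)) :
    HasSum (V.indicator (μ.ball h)) (μ.toFun (cyl h V)) := by
  rw [← hasSum_subtype_iff_indicator]
  have := μ.hasSum_iUnion h V (fun c => proj p h ⁻¹' {c.1}) (fun c => ⟨_, rfl⟩) (fun c d hcd => by
    refine Disjoint.preimage _ ?_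
    simpa using fun h => hcd (Subtype.ext h))
  convert! this using 2
  refine Subtype.ext ?_
  ext x
  simp [cyl]

theorem hasSum_ball (μ : UnifMeasure p) (h : ℕ) :
    HasSum (μ.ball h) (μ.toFun (cyl h univ)) := by
  simpa using μ.hasSum_cyl h univ

/-- For `h ≤ h'` the projection `ℚ_p / p ^ h' ℤ_p → ℚ_p / p ^ h ℤ_p`. -/
def transition {h h' : ℕ} (hh : h ≤ h') : Balls p h' →+ Balls p h :=
  QuotientAddGroup.map _ _ (AddMonoidHom.id _) (fun x hx => by
    refine le_trans (α := ℝ) hx ?_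
    have : (1 : ℝ) ≤ p := by exact_mod_cast (Fact.out : p.Prime).one_lt.le
    exact zpow_le_zpow_right₀ this (by omega))

theorem transition_proj {h h' : ℕ} (hh : h ≤ h') (x : ℚ_[p]) :
    transition hh (proj p h' x) = proj p h x := rfl

theorem cyl_transition {h h' : ℕ} (hh : h ≤ h') (V : Set (Balls p h)) :
    cyl h' (transition hh ⁻¹' V) = cyl h V := rfl

instance : NonarchimedeanRing ℤ_[p] where
  is_nonarchimedean := NonarchimedeanAddGroup.is_nonarchimedean

/-- The value at `π_h⁻¹(V)` of the convolution of `μ` and `ν`, which is the value of the product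
measure `μ × ν` at `{(x, y) | x + y ∈ π_h⁻¹(V)}`. -/
def convAt (μ ν : UnifMeasure p) (h : ℕ) (V : Set (Balls p h)) : ℤ_[p] :=
  ∑' c : Balls p h × Balls p h,
    {c : Balls p h × Balls p h | c.1 + c.2 ∈ V}.indicator (fun c => μ.ball h c.1 * ν.ball h c.2) c

theorem summable_conv (μ ν : UnifMeasure p) (h : ℕ) :
    Summable (fun c : Balls p h × Balls p h => μ.ball h c.1 * ν.ball h c.2) :=
  ((μ.hasSum_ball h).mul_of_nonarchimedean (ν.hasSum_ball h)).summable

theorem hasSum_convAt (μ ν : UnifMeasure p) (h : ℕ) (V : Set (Balls p h)) :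
    HasSum ({c : Balls p h × Balls p h | c.1 + c.2 ∈ V}.indicator
      (fun c => μ.ball h c.1 * ν.ball h c.2)) (convAt μ ν h V) :=
  ((summable_conv μ ν h).indicator _).hasSum

theorem convAt_transition (μ ν : UnifMeasure p) {h h' : ℕ} (hh : h ≤ h') (V : Set (Balls p h)) :
    convAt μ ν h' (transition hh ⁻¹' V) = convAt μ ν h V := by
  have h1 := (hasSum_convAt μ ν h' (transition hh ⁻¹' V)).tsum_fiberwise
    (fun c => (transition hh c.1, transition hh c.2))
  refine (h1.unique ?_)
  convert! hasSum_convAt μ ν h V using 1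
  ext ⟨c, d⟩
  have hc := μ.hasSum_cyl h' (transition hh ⁻¹' {c})
  have hd := ν.hasSum_cyl h' (transition hh ⁻¹' {d})
  have hcd := hc.mul_of_nonarchimedean hd
  rw [cyl_transition, cyl_transition] at hcd
  rw [tsum_subtype]
  by_cases hV : c + d ∈ V
  · rw [indicator_of_mem (by exact hV)]
    refine HasSum.tsum_eq ?_
    convert! hcd using 1
    ext ⟨c', d'⟩
    classical
    simp only [indicator_apply, mem_preimage, mem_singleton_iff, Prod.mk.injEq, mem_ofPred_eq, map_add]
    by_cases h1 : transition hh c' = c <;> by_cases h2 : transition hh d' = d <;> simp [h1, h2, hV]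
  · rw [indicator_of_notMem (by exact hV)]
    refine HasSum.tsum_eq ?_
    convert! hasSum_zero using 1
    ext ⟨c', d'⟩
    classical
    simp only [indicator_apply, mem_preimage, mem_singleton_iff, Prod.mk.injEq, mem_ofPred_eq, map_add]
    by_cases h1 : transition hh c' = c <;> by_cases h2 : transition hh d' = d <;> simp [h1, h2, hV]

theorem proj_image_preimage {h : ℕ} (V : Set (Balls p h)) : proj p h '' (proj p h ⁻¹' V) = V :=
  image_preimage_eq _ (proj_surjective h)

/-- The value at `U` of the convolution of `μ` and `ν`; see `convFun_eq` for the independence of the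
choice of a radius of `U`. -/
def convFun (μ ν : UnifMeasure p) (U : unifSets p) : ℤ_[p] :=
  convAt μ ν (mem_iUnion.1 U.2).choose (proj p _ '' U.1)

theorem convFun_eq (μ ν : UnifMeasure p) (h : ℕ) (V : Set (Balls p h)) :
    convFun μ ν (cyl h V) = convAt μ ν h V := by
  unfold convFun
  generalize_proofs hex
  obtain ⟨W, hW⟩ := hex.choose_spec
  generalize hex.choose = h₀ at *
  rw [hW, proj_image_preimage]
  rw [← convAt_transition μ ν (le_max_left h h₀), ← convAt_transition μ ν (le_max_right h h₀)]
  congr 1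
  have h2 : proj p (max h h₀) ⁻¹' (transition (le_max_right h h₀) ⁻¹' W)
      = proj p (max h h₀) ⁻¹' (transition (le_max_left h h₀) ⁻¹' V) := hW.symm
  exact (proj_surjective _).preimage_injective h2

/-- The product of uniform measures is convolution. -/
instance : Mul (UnifMeasure p) := ⟨fun μ ν =>
  { toFun := convFun μ ν
    hasSum_iUnion := fun h ι U hU hd => by
      have hU2 := hU
      choose V hV using hU2
      obtain rfl : U = fun i => proj p h ⁻¹' V i := funext hV
      have e1 : ∀ i, convFun μ ν ⟨proj p h ⁻¹' V i, mem_unifSets ⟨V i, rfl⟩⟩ = convAt μ ν h (V i) :=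
        fun i => convFun_eq μ ν h (V i)
      have e2 : convFun μ ν ⟨⋃ i, proj p h ⁻¹' V i, mem_unifSets (iUnion_mem fun i => ⟨V i, rfl⟩)⟩
          = convAt μ ν h (⋃ i, V i) := by
        rw [← convFun_eq]
        congr 1
        exact Subtype.ext preimage_iUnion.symm
      rw [e2]
      simp only [e1]
      have hdV : ∀ {c i j}, c ∈ V i → c ∈ V j → i = j := by
        intro c i j hi hj
        by_contra hij
        obtain ⟨x, rfl⟩ := proj_surjective h c
        exact disjoint_left.1 (hd hij) hi hj
      have H := hasSum_convAt μ ν h (⋃ i, V i)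
      rw [← hasSum_subtype_iff_indicator] at H
      have hidx : ∀ c : {c : Balls p h × Balls p h | c.1 + c.2 ∈ ⋃ i, V i},
          ∃ i, c.1.1 + c.1.2 ∈ V i := fun c => mem_iUnion.1 c.2
      choose idx hidx using hidx
      convert! H.tsum_fiberwise idx using 1
      ext i
      refine (HasSum.tsum_eq ?_).symm
      have K := hasSum_convAt μ ν h (V i)
      rw [← hasSum_subtype_iff_indicator] at K
      let e : (idx ⁻¹' {i}) ≃ {c : Balls p h × Balls p h | c.1 + c.2 ∈ V i} :=
        { toFun := fun c => ⟨c.1.1, by have := hidx c.1; rwa [show idx c.1 = i from c.2] at this⟩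
          invFun := fun c => ⟨⟨c.1, mem_iUnion.2 ⟨i, c.2⟩⟩, hdV (hidx _) c.2⟩
          left_inv := fun _ => rfl
          right_inv := fun _ => rfl }
      exact e.hasSum_iff.2 K }⟩

theorem mul_cyl (μ ν : UnifMeasure p) (h : ℕ) (V : Set (Balls p h)) :
    (μ * ν).toFun (cyl h V) = ∑' c : Balls p h × Balls p h,
      {c : Balls p h × Balls p h | c.1 + c.2 ∈ V}.indicator
        (fun c => μ.ball h c.1 * ν.ball h c.2) c :=
  convFun_eq μ ν h V

/-- The unit is the Dirac mass at the origin. -/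
instance : One (UnifMeasure p) := ⟨dirac 0⟩

theorem ext_cyl {μ ν : UnifMeasure p}
    (H : ∀ (h : ℕ) (V : Set (Balls p h)), μ.toFun (cyl h V) = ν.toFun (cyl h V)) : μ = ν := by
  refine UnifMeasure.ext (funext fun U => ?_)
  obtain ⟨U, hU⟩ := U
  obtain ⟨h, V, rfl⟩ := mem_iUnion.1 hU
  exact H h V

theorem hasSum_mul (μ ν : UnifMeasure p) (h : ℕ) (V : Set (Balls p h)) :
    HasSum ({c : Balls p h × Balls p h | c.1 + c.2 ∈ V}.indicator
      (fun c => μ.ball h c.1 * ν.ball h c.2)) ((μ * ν).toFun (cyl h V)) := by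
  rw [mul_cyl]
  exact hasSum_convAt μ ν h V

theorem mul_comm_aux (μ ν : UnifMeasure p) : μ * ν = ν * μ := by
  refine ext_cyl fun h V => ?_
  refine (hasSum_mul μ ν h V).unique ?_
  rw [← (Equiv.prodComm _ _).hasSum_iff]
  convert! hasSum_mul ν μ h V using 1
  ext ⟨c, d⟩
  classical
  simp [indicator_apply, add_comm, mul_comm]

theorem hasSum_mul_mul (μ ν ρ : UnifMeasure p) (h : ℕ) (V : Set (Balls p h)) :
    HasSum ({x : (Balls p h × Balls p h) × Balls p h | x.1.1 + x.1.2 + x.2 ∈ V}.indicator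
      (fun x => μ.ball h x.1.1 * ν.ball h x.1.2 * ρ.ball h x.2)) ((μ * ν * ρ).toFun (cyl h V)) := by
  have hs := (((μ.hasSum_ball h).mul_of_nonarchimedean (ν.hasSum_ball h)).mul_of_nonarchimedean
    (ρ.hasSum_ball h)).summable.indicator
      {x : (Balls p h × Balls p h) × Balls p h | x.1.1 + x.1.2 + x.2 ∈ V}
  have h1 := hs.hasSum.tsum_fiberwise (fun x => (x.1.1 + x.1.2, x.2))
  convert! hs.hasSum using 1
  refine (hasSum_mul (μ * ν) ρ h V).unique ?_
  convert! h1 using 1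
  ext ⟨c, d⟩
  rw [tsum_subtype]
  symm
  refine HasSum.tsum_eq ?_
  have h2 := hasSum_mul μ ν h {c}
  have h3 : HasSum (fun e : Balls p h => ({d} : Set (Balls p h)).indicator (ρ.ball h) e)
    (ρ.ball h d) := ρ.hasSum_cyl h {d}
  have h4 := h2.mul_of_nonarchimedean h3
  classical
  by_cases hV : c + d ∈ V
  · rw [indicator_of_mem (by exact hV)]
    convert! h4 using 1
    ext ⟨⟨a, b⟩, e⟩
    simp only [indicator_apply, mem_preimage, mem_singleton_iff, Prod.mk.injEq, mem_ofPred_eq]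
    by_cases e1 : a + b = c <;> by_cases e2 : e = d <;> simp [e1, e2, hV]
  · rw [indicator_of_notMem (by exact hV)]
    convert! hasSum_zero using 1
    ext ⟨⟨a, b⟩, e⟩
    simp only [indicator_apply, mem_preimage, mem_singleton_iff, Prod.mk.injEq, mem_ofPred_eq]
    by_cases e1 : a + b = c <;> by_cases e2 : e = d <;> simp [e1, e2, hV]

theorem mul_assoc_aux (μ ν ρ : UnifMeasure p) : μ * ν * ρ = μ * (ν * ρ) := by
  rw [mul_comm_aux μ (ν * ρ)]
  refine ext_cyl fun h V => ?_
  refine (hasSum_mul_mul μ ν ρ h V).unique ?_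
  let e : (Balls p h × Balls p h) × Balls p h ≃ (Balls p h × Balls p h) × Balls p h :=
    { toFun := fun x => ((x.1.2, x.2), x.1.1)
      invFun := fun x => ((x.2, x.1.1), x.1.2)
      left_inv := fun _ => rfl
      right_inv := fun _ => rfl }
  convert! e.hasSum_iff.2 (hasSum_mul_mul ν ρ μ h V) using 1
  ext ⟨⟨a, b⟩, c⟩
  classical
  have e1 : b + c + a = a + b + c := by abel
  have e2 : ν.ball h b * ρ.ball h c * μ.ball h a = μ.ball h a * ν.ball h b * ρ.ball h c := by ring
  simp only [indicator_apply, mem_ofPred_eq, Function.comp_apply, e, Equiv.coe_fn_mk, e1, e2]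

theorem one_ball (h : ℕ) (c : Balls p h) [Decidable (c = 0)] :
    (1 : UnifMeasure p).ball h c = if c = 0 then 1 else 0 := by
  classical
  change (if (0 : ℚ_[p]) ∈ proj p h ⁻¹' {c} then (1 : ℤ_[p]) else 0) = _
  have : (0 : ℚ_[p]) ∈ proj p h ⁻¹' {c} ↔ c = 0 := by
    rw [mem_preimage, mem_singleton_iff]
    exact eq_comm
  simp only [this]

theorem one_mul_aux (μ : UnifMeasure p) : 1 * μ = μ := by
  refine ext_cyl fun h V => ?_
  refine (hasSum_mul 1 μ h V).unique ?_
  have hinj : Function.Injective (fun d : Balls p h => ((0 : Balls p h), d)) := fun a b hab => by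
    simpa using hab
  classical
  rw [← hinj.hasSum_iff]
  · convert! μ.hasSum_cyl h V using 1
    ext d
    simp [indicator_apply, one_ball]
  · rintro ⟨c, d⟩ hcd
    have : c ≠ 0 := by
      rintro rfl
      exact hcd ⟨d, rfl⟩
    simp [indicator_apply, one_ball, this]

theorem add_mul_aux (μ ν ρ : UnifMeasure p) : (μ + ν) * ρ = μ * ρ + ν * ρ := by
  refine ext_cyl fun h V => ?_
  refine (hasSum_mul (μ + ν) ρ h V).unique ?_
  convert! (hasSum_mul μ ρ h V).add (hasSum_mul ν ρ h V) using 1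
  ext ⟨c, d⟩
  have : (μ + ν).ball h c = μ.ball h c + ν.ball h c := rfl
  classical
  simp only [indicator_apply, this]
  split_ifs <;> ring

theorem smul_mul_aux (a : ℤ_[p]) (μ ν : UnifMeasure p) : (a • μ) * ν = a • (μ * ν) := by
  refine ext_cyl fun h V => ?_
  refine (hasSum_mul (a • μ) ν h V).unique ?_
  convert! (hasSum_mul μ ν h V).mul_left a using 1
  ext ⟨c, d⟩
  have : (a • μ).ball h c = a * μ.ball h c := rfl
  classical
  simp only [indicator_apply, this]
  split_ifs <;> ring

instance : CommRing (UnifMeasure p) where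
  mul_assoc := mul_assoc_aux
  mul_comm := mul_comm_aux
  one_mul := one_mul_aux
  mul_one μ := by rw [mul_comm_aux, one_mul_aux]
  left_distrib μ ν ρ := by
    rw [mul_comm_aux, add_mul_aux, mul_comm_aux ν, mul_comm_aux ρ]
  right_distrib := add_mul_aux
  zero_mul μ := by
    have := add_mul_aux 0 0 μ
    rw [add_zero] at this
    exact left_eq_add.1 this
  mul_zero μ := by
    have := add_mul_aux 0 0 μ
    rw [add_zero] at this
    rw [mul_comm_aux]
    exact left_eq_add.1 this
  zsmul := fun n μ => n • μ
  zsmul_zero' := zero_zsmul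
  zsmul_succ' := fun n a => by exact SubNegMonoid.zsmul_succ' n a
  zsmul_neg' := fun n a => by exact SubNegMonoid.zsmul_neg' n a
  neg_add_cancel := neg_add_cancel
  sub_eq_add_neg := sub_eq_add_neg
  nsmul := fun n μ => n • μ
  nsmul_zero := zero_nsmul
  nsmul_succ := fun n a => by exact AddMonoid.nsmul_succ n a

instance : Algebra ℤ_[p] (UnifMeasure p) :=
  Algebra.ofModule smul_mul_aux (fun a μ ν => by
    rw [mul_comm, smul_mul_aux, mul_comm])

/-- The natural topology (and uniformity) on uniform measures: uniform convergence on the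
uniformly measurable sets of one and the same radius, for every radius. -/
instance : UniformSpace (UnifMeasure p) :=
  UniformSpace.comap
    (fun μ => UniformOnFun.ofFun (range fun h : ℕ => {U : unifSets p | U.1 ∈ unifSetsOfRadius p h})
      μ.toFun) inferInstance

end UnifMeasure

open UnifMeasure

variable (p)

/-- The measure `T_n = Δ_{1 / p ^ n} - Δ_0`. -/
def T (n : ℕ) : UnifMeasure p := dirac (1 / (p : ℚ_[p]) ^ n) - dirac 0

/-- The `p`-adic topology on the ring of uniform measures. -/
@[reducible]
def pAdicTopology : TopologicalSpace (UnifMeasure p) :=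
  (Ideal.span {(p : UnifMeasure p)}).adicTopology

/-- `T̃_n`, the limit of `T_{n + m} ^ (p ^ m)` for `m → ∞` in the `p`-adic topology. -/
def tT (n : ℕ) : UnifMeasure p :=
  @limUnder _ (pAdicTopology p) _ ⟨0⟩ atTop (fun m : ℕ => T p (n + m) ^ p ^ m)

/-- The monoid `S` of the real numbers in `ℤ[1 / p]` that are `≥ 0`. -/
def S : AddSubmonoid ℝ where
  carrier := {q | ∃ m n : ℕ, q = m / (p : ℝ) ^ n}
  zero_mem' := ⟨0, 0, by simp⟩
  add_mem' := by
    rintro _ _ ⟨m, n, rfl⟩ ⟨m', n', rfl⟩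
    have : (p : ℝ) ≠ 0 := by exact_mod_cast (Fact.out : p.Prime).ne_zero
    exact ⟨m * p ^ n' + m' * p ^ n, n + n', by push_cast; field_simp; ring⟩

variable {p}

/-- `T̃ ^ q` for `q = m / p ^ n` in `S`, that is, `T̃_n ^ m`. -/
def tPow (q : S p) : UnifMeasure p := tT p q.2.choose_spec.choose ^ q.2.choose

variable (p)

/-- The subring `ℤ[T̃ ^ (1 / p ^ ∞)]`, generated by the `T̃_n`. -/
def ZT : Subring (UnifMeasure p) := Subring.closure (range (tT p))

variable {p}

/-- The `p`-adic valuation of `ℤ_p`, with value `∞` at `0`. -/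
def vp (a : ℤ_[p]) : WithTop ℝ :=
  open Classical in if a = 0 then ⊤ else ((a.valuation : ℝ) : WithTop ℝ)

/-- `v(a) + q`, the weight of the term `a T̃ ^ q`. -/
def weight (a : ℤ_[p]) (q : S p) : WithTop ℝ := vp a + ((q : ℝ) : WithTop ℝ)

/-- For any `C > 0`, `v(a_q) + q > C` for almost all `q`. -/
def WeightsTendToTop (a : S p → ℤ_[p]) : Prop :=
  ∀ C : ℝ, 0 < C → ∀ᶠ q in cofinite, (C : WithTop ℝ) < weight (a q) q

/-- The uniform structure (and topology) on a ring that is induced by an additive valuation. -/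
@[reducible]
def valUniformSpace {A : Type} [CommRing A] (w : AddValuation A (WithTop ℝ)) : UniformSpace A :=
  (Valued.mk' (AddValuation.toValuation w)).toUniformSpace

/-- `i : A → B` exhibits the topological ring `B` as the completion of `A` for the valuation `w`:
`B` is separated and complete, `A` is dense in it and the uniformity of `B` induces that of `w`. -/
structure IsValuationCompletion {A B : Type} [CommRing A] [CommRing B] [UniformSpace B]
    (w : AddValuation A (WithTop ℝ)) (i : A →+* B) : Prop where
  isTopologicalRing : IsTopologicalRing B
  isUniformAddGroup : IsUniformAddGroup B
  completeSpace : CompleteSpace B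
  t2Space : T2Space B
  isUniformInducing : @IsUniformInducing A B (valUniformSpace w) _ i
  denseRange : DenseRange i

end PadicMeasures

end

open PadicMeasures

/-!
Divisibility of a measure by `p ^ n` means divisibility of all its values, so the topology has the
basis `nbhdIdeal p n n`. As `T̃ ^ (p ^ h)` is divisible by `p` on the balls of radius `h`, terms
`a T̃ ^ q` of large weight are small, and the `S`-series converge. Conversely, `Δ_{p ^ n}` is the
limit of `(1 + T̃_k) ^ (p ^ (k + n))`, and the `p`-adic valuations of the binomial coefficients show
that `Δ_{p ^ n} - 1` is a limit of sums of terms of weight at least `n`. Dirac masses in the same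
ball of radius `n` thus differ by such a limit, and every element of `nbhdIdeal p n n` is one.
Successive approximation yields the expansions, and the topology of `w` is the natural one.

The expansion is unique because modulo `p` and at radius `h` a series reduces to a polynomial in
`Δ_{1 / p ^ n}` of degree less than `p ^ (n + h)`, and the powers of `Δ_{1 / p ^ n}` below that
degree are carried by distinct balls. The valuation is multiplicative because leading homogeneous
parts are finite sums, and in a product of two of them some exponent arises only once.
-/

noncomputable section

open Filter Topology Set

namespace PadicMeasures

open UnifMeasure

section Sums

theorem dvd_indicator {α R : Type*} [SemigroupWithZero R] {a : R} {s : Set α} {f : α → R}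
    (hf : ∀ i ∈ s, a ∣ f i) (i : α) : a ∣ s.indicator f i := by
  by_cases hi : i ∈ s
  · rw [indicator_of_mem hi]
    exact hf i hi
  · rw [indicator_of_notMem hi]
    exact dvd_zero a

theorem hasSum_mem_of_isClosed {ι G σ : Type*} [AddCommMonoid G] [TopologicalSpace G]
    [SetLike σ G] [AddSubmonoidClass σ G] {s : σ} (hs : IsClosed (s : Set G)) {f : ι → G} {x : G}
    (hf : ∀ i, f i ∈ s) (h : HasSum f x) : x ∈ s :=
  hs.mem_of_tendsto h (Eventually.of_forall fun _ => sum_mem fun i _ => hf i)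

theorem exists_hasSum_of_approx {G : Type*} [AddCommGroup G] [TopologicalSpace G]
    [IsTopologicalAddGroup G] {U : ℕ → AddSubgroup G} (hU : Antitone U)
    (hbasis : (𝓝 (0 : G)).HasBasis (fun _ : ℕ => True) fun n => (U n : Set G)) {Y : ℕ → Set G}
    (hYU : ∀ n, Y n ⊆ U n) (happrox : ∀ n, ∀ x ∈ U n, ∃ y ∈ Y n, x - y ∈ U (n + 1)) {x : G}
    (hx : x ∈ U 0) : ∃ y : ℕ → G, (∀ n, y n ∈ Y n) ∧ HasSum y x := by
  choose! y hyY hyU using happrox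
  let r : ℕ → G := Nat.rec x fun n z => z - y n z
  have hrU : ∀ n, r n ∈ U n := Nat.rec hx fun n hn => hyU n _ hn
  have hsum : ∀ n, x - ∑ i ∈ Finset.range n, y i (r i) = r n := by
    intro n
    induction n with
    | zero => simp [r]
    | succ n ih => rw [Finset.sum_range_succ, ← sub_sub, ih]
  refine ⟨fun n => y n (r n), fun n => hyY n _ (hrU n), ?_⟩
  rw [HasSum, SummationFilter.unconditional_filter, ← tendsto_sub_nhds_zero_iff,
    hbasis.tendsto_right_iff]
  intro n _
  filter_upwards [eventually_ge_atTop (Finset.range n)] with s hs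
  have htail : ∑ i ∈ s \ Finset.range n, y i (r i) ∈ U n := sum_mem fun i hi =>
    hU (by simpa using (Finset.mem_sdiff.1 hi).2) (hYU i (hyY i _ (hrU i)))
  rw [← Finset.sum_sdiff hs, add_sub_assoc, ← neg_sub x, hsum]
  exact add_mem htail (neg_mem (hrU n))

end Sums

variable {p : ℕ} [Fact p.Prime]

section PadicInt

theorem pow_dvd_iff_norm_le (x : ℤ_[p]) (n : ℕ) :
    (p : ℤ_[p]) ^ n ∣ x ↔ ‖x‖ ≤ (p : ℝ) ^ (-(n : ℤ)) := by
  rw [PadicInt.norm_le_pow_iff_mem_span_pow, Ideal.mem_span_singleton]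

theorem isClosed_span_pow (n : ℕ) :
    IsClosed ((Ideal.span {(p : ℤ_[p]) ^ n} : Ideal ℤ_[p]) : Set ℤ_[p]) := by
  have hball : ((Ideal.span {(p : ℤ_[p]) ^ n} : Ideal ℤ_[p]) : Set ℤ_[p]) =
      {x | ‖x‖ ≤ (p : ℝ) ^ (-(n : ℤ))} :=
    Set.ext fun x => (PadicInt.norm_le_pow_iff_mem_span_pow x n).symm
  rw [hball]
  exact isClosed_le continuous_norm continuous_const

theorem pow_dvd_of_hasSum {ι : Type*} {f : ι → ℤ_[p]} {x : ℤ_[p]} {n : ℕ}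
    (hf : ∀ i, (p : ℤ_[p]) ^ n ∣ f i) (h : HasSum f x) : (p : ℤ_[p]) ^ n ∣ x :=
  Ideal.mem_span_singleton.1 <| hasSum_mem_of_isClosed (isClosed_span_pow n)
    (fun i => Ideal.mem_span_singleton.2 (hf i)) h

theorem padicInt_hasBasis_nhds_zero :
    (𝓝 (0 : ℤ_[p])).HasBasis (fun _ : ℕ => True) fun n => {x | (p : ℤ_[p]) ^ n ∣ x} := by
  have hp : (1 : ℝ) < p := by exact_mod_cast (Fact.out : p.Prime).one_lt
  convert! Metric.nhds_basis_closedBall_pow (x := (0 : ℤ_[p])) (by positivity)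
    (inv_lt_one_of_one_lt₀ hp) using 2 with n
  ext x
  simp [pow_dvd_iff_norm_le]

theorem padicInt_hasBasis_uniformity :
    (uniformity ℤ_[p]).HasBasis (fun _ : ℕ => True) fun n => {x | (p : ℤ_[p]) ^ n ∣ x.2 - x.1} := by
  rw [uniformity_eq_comap_nhds_zero]
  exact padicInt_hasBasis_nhds_zero.comap _

theorem padicInt_hasSum_iff {ι : Type*} {f : ι → ℤ_[p]} {x : ℤ_[p]} :
    HasSum f x ↔ ∀ n : ℕ, ∀ᶠ s in atTop, (p : ℤ_[p]) ^ n ∣ ∑ i ∈ s, f i - x := by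
  rw [HasSum, SummationFilter.unconditional_filter, ← tendsto_sub_nhds_zero_iff,
    padicInt_hasBasis_nhds_zero.tendsto_right_iff]
  simp only [true_imp_iff, mem_ofPred_eq]

theorem padicInt_hasSum_of_pow_mul {ι : Type*} {f : ι → ℤ_[p]} {x : ℤ_[p]} {k : ℕ}
    (h : HasSum (fun i => (p : ℤ_[p]) ^ k * f i) ((p : ℤ_[p]) ^ k * x)) : HasSum f x := by
  rw [padicInt_hasSum_iff] at h ⊢
  intro n
  filter_upwards [h (k + n)] with s hs
  rw [← Finset.mul_sum, ← mul_sub, pow_add] at hs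
  exact (mul_dvd_mul_iff_left (pow_ne_zero k PadicInt.prime_p.ne_zero)).1 hs

theorem eq_zero_of_forall_pow_dvd {x : ℤ_[p]} (h : ∀ n : ℕ, (p : ℤ_[p]) ^ n ∣ x) : x = 0 := by
  by_contra hx
  have := (PadicInt.mem_span_pow_iff_le_valuation x hx (x.valuation + 1)).1
    (Ideal.mem_span_singleton.2 (h _))
  omega

end PadicInt

section NbhdIdeal

theorem sub_ball (μ ν : UnifMeasure p) (h : ℕ) (c : Balls p h) :
    (μ - ν).ball h c = μ.ball h c - ν.ball h c := rfl

theorem smul_ball (a : ℤ_[p]) (μ : UnifMeasure p) (h : ℕ) (c : Balls p h) :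
    (a • μ).ball h c = a * μ.ball h c := rfl

theorem ball_transition (μ : UnifMeasure p) {h h' : ℕ} (hh : h ≤ h') (c : Balls p h) :
    μ.ball h c = μ.toFun (cyl h' (transition hh ⁻¹' {c})) := rfl

theorem pow_dvd_mul_ball {h k l : ℕ} {μ ν : UnifMeasure p}
    (hμ : ∀ c, (p : ℤ_[p]) ^ k ∣ μ.ball h c) (hν : ∀ c, (p : ℤ_[p]) ^ l ∣ ν.ball h c)
    (c : Balls p h) : (p : ℤ_[p]) ^ (k + l) ∣ (μ * ν).ball h c :=
  pow_dvd_of_hasSum (fun d => pow_add (p : ℤ_[p]) k l ▸ dvd_indicator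
    (fun d _ => mul_dvd_mul (hμ d.1) (hν d.2)) d) (hasSum_mul μ ν h {c})

/-- The ideal of the measures whose values at the sets of radius `h` are divisible by `p ^ l`,
a basic neighbourhood of zero in the natural topology. Divisibility is required at the balls only;
see `mem_nbhdIdeal_iff_cyl`. -/
def nbhdIdeal (p : ℕ) [Fact p.Prime] (h l : ℕ) : Ideal (UnifMeasure p) where
  carrier := {μ | ∀ c : Balls p h, (p : ℤ_[p]) ^ l ∣ μ.ball h c}
  zero_mem' _ := dvd_zero _
  add_mem' ha hb c := dvd_add (ha c) (hb c)
  smul_mem' ν μ hμ c := by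
    simpa only [zero_add, smul_eq_mul] using
      pow_dvd_mul_ball (k := 0) (fun _ => by rw [pow_zero]; exact one_dvd _) hμ c

theorem mem_nbhdIdeal_iff_cyl {h l : ℕ} {μ : UnifMeasure p} :
    μ ∈ nbhdIdeal p h l ↔ ∀ V : Set (Balls p h), (p : ℤ_[p]) ^ l ∣ μ.toFun (cyl h V) :=
  ⟨fun H V => pow_dvd_of_hasSum (dvd_indicator fun c _ => H c) (μ.hasSum_cyl h V), fun H _ => H _⟩

theorem nbhdIdeal_anti {h h' l l' : ℕ} (hh : h ≤ h') (hl : l ≤ l') :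
    nbhdIdeal p h' l' ≤ nbhdIdeal p h l := fun μ hμ c => by
  rw [ball_transition μ hh]
  exact (pow_dvd_pow _ hl).trans (mem_nbhdIdeal_iff_cyl.1 hμ _)

theorem mul_mem_nbhdIdeal {h k l : ℕ} {μ ν : UnifMeasure p} (hμ : μ ∈ nbhdIdeal p h k)
    (hν : ν ∈ nbhdIdeal p h l) : μ * ν ∈ nbhdIdeal p h (k + l) :=
  pow_dvd_mul_ball hμ hν

theorem nbhdIdeal_zero (h : ℕ) : nbhdIdeal p h 0 = ⊤ :=
  (Ideal.eq_top_iff_one _).2 fun _ => by simp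

theorem pow_mem_nbhdIdeal {h l : ℕ} {μ : UnifMeasure p} (hμ : μ ∈ nbhdIdeal p h l) (k : ℕ) :
    μ ^ k ∈ nbhdIdeal p h (l * k) := by
  induction k with
  | zero => simp [nbhdIdeal_zero]
  | succ k ih => rw [pow_succ, mul_add, mul_one]; exact mul_mem_nbhdIdeal ih hμ

theorem smul_mem_nbhdIdeal {a : ℤ_[p]} {l : ℕ} (ha : (p : ℤ_[p]) ^ l ∣ a) (h : ℕ)
    (μ : UnifMeasure p) : a • μ ∈ nbhdIdeal p h l := fun c => by
  rw [smul_ball]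
  exact ha.mul_right _

theorem eq_zero_of_forall_mem_nbhdIdeal {μ : UnifMeasure p} (H : ∀ n, μ ∈ nbhdIdeal p n n) :
    μ = 0 :=
  ext_cyl fun h V => eq_zero_of_forall_pow_dvd fun n =>
    mem_nbhdIdeal_iff_cyl.1 (nbhdIdeal_anti (le_max_left h n) (le_max_right h n) (H _)) V

end NbhdIdeal

section NaturalTopology

/-- The family of the uniformly measurable sets of radius `h`, for `h : ℕ`, on which convergence in
the natural topology is uniform. -/
abbrev radiusClasses (p : ℕ) [Fact p.Prime] : Set (Set (unifSets p)) :=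
  range fun h : ℕ => {U : unifSets p | U.1 ∈ unifSetsOfRadius p h}

theorem directedOn_radiusClasses : DirectedOn (· ⊆ ·) (radiusClasses p) := by
  have hmono : ∀ {h h' : ℕ}, h ≤ h' → {U : unifSets p | U.1 ∈ unifSetsOfRadius p h} ⊆
      {U : unifSets p | U.1 ∈ unifSetsOfRadius p h'} := by
    rintro h h' hh ⟨U, hU⟩ ⟨V, rfl⟩
    exact ⟨transition hh ⁻¹' V, rfl⟩
  rintro _ ⟨h, rfl⟩ _ ⟨h', rfl⟩
  exact ⟨_, ⟨max h h', rfl⟩, hmono (le_max_left _ _), hmono (le_max_right _ _)⟩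

/-- `UnifMeasure.toFun` with values in the function space whose uniform structure induces the one of
`UnifMeasure p`. -/
def toUniformOnFunHom : UnifMeasure p →+ UniformOnFun (unifSets p) ℤ_[p] (radiusClasses p) where
  toFun μ := UniformOnFun.ofFun _ μ.toFun
  map_zero' := rfl
  map_add' _ _ := rfl

theorem isUniformInducing_toUniformOnFunHom :
    IsUniformInducing (toUniformOnFunHom : UnifMeasure p → _) := ⟨rfl⟩

instance : IsUniformAddGroup (UnifMeasure p) :=
  IsUniformAddGroup.comap (toUniformOnFunHom (p := p))

theorem hasBasis_uniformity : (uniformity (UnifMeasure p)).HasBasis (fun _ : ℕ => True)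
    fun n => {x | x.2 - x.1 ∈ nbhdIdeal p n n} := by
  refine (isUniformInducing_toUniformOnFunHom.basis_uniformity
    (UniformOnFun.hasBasis_uniformity_of_basis (unifSets p) ℤ_[p] (radiusClasses p) ⟨_, 0, rfl⟩
      directedOn_radiusClasses padicInt_hasBasis_uniformity)).to_hasBasis ?_ ?_
  · rintro ⟨_, l⟩ ⟨⟨h, rfl⟩, -⟩
    refine ⟨max h l, trivial, ?_⟩
    rintro ⟨μ, ν⟩ hμν ⟨U, hU⟩ ⟨V, rfl⟩
    exact mem_nbhdIdeal_iff_cyl.1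
      (nbhdIdeal_anti (le_max_left h l) (le_max_right h l) hμν) V
  · rintro n -
    refine ⟨⟨_, n⟩, ⟨⟨n, rfl⟩, trivial⟩, ?_⟩
    rintro ⟨μ, ν⟩ hμν c
    exact hμν (cyl n {c}) ⟨{c}, rfl⟩

theorem hasBasis_nhds_zero : (𝓝 (0 : UnifMeasure p)).HasBasis (fun _ : ℕ => True)
    fun n => (nbhdIdeal p n n : Set (UnifMeasure p)) := by
  convert! nhds_basis_uniformity hasBasis_uniformity (x := (0 : UnifMeasure p)) using 2 with n
  ext μ
  simp

instance : IsTopologicalRing (UnifMeasure p) := by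
  have htendsto_mul : ∀ μ : UnifMeasure p, Tendsto (fun ν => μ * ν) (𝓝 0) (𝓝 0) := fun μ =>
    (hasBasis_nhds_zero.tendsto_iff hasBasis_nhds_zero).2 fun n _ =>
      ⟨n, trivial, fun _ hν => Ideal.mul_mem_left _ _ hν⟩
  refine IsTopologicalRing.of_addGroup_of_nhds_zero ?_ htendsto_mul fun μ => by
    simpa only [mul_comm] using htendsto_mul μ
  exact (hasBasis_nhds_zero.prod_self.tendsto_iff hasBasis_nhds_zero).2 fun n _ =>
    ⟨n, trivial, fun _ hν => Ideal.mul_mem_left _ _ hν.2⟩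

theorem isOpen_nbhdIdeal (h l : ℕ) : IsOpen (nbhdIdeal p h l : Set (UnifMeasure p)) :=
  (nbhdIdeal p h l).toAddSubgroup.isOpen_of_mem_nhds (g := 0) <|
    mem_of_superset (hasBasis_nhds_zero.mem_of_mem (i := max h l) trivial)
      (nbhdIdeal_anti (le_max_left h l) (le_max_right h l))

theorem isClosed_nbhdIdeal (h l : ℕ) : IsClosed (nbhdIdeal p h l : Set (UnifMeasure p)) :=
  (nbhdIdeal p h l).toAddSubgroup.isClosed_of_isOpen (isOpen_nbhdIdeal h l)

instance : NonarchimedeanAddGroup (UnifMeasure p) where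
  is_nonarchimedean U hU := by
    obtain ⟨n, -, hn⟩ := hasBasis_nhds_zero.mem_iff.1 hU
    exact ⟨⟨(nbhdIdeal p n n).toAddSubgroup, isOpen_nbhdIdeal n n⟩, hn⟩

instance : T2Space (UnifMeasure p) := by
  refine IsTopologicalAddGroup.t2Space_of_zero_sep fun μ hμ => ?_
  by_contra! H
  exact hμ (eq_zero_of_forall_mem_nbhdIdeal fun n => H _ (hasBasis_nhds_zero.mem_of_mem trivial))

theorem tendsto_iff_eventually_sub_mem {ι : Type*} {f : ι → UnifMeasure p} {l : Filter ι}
    {μ : UnifMeasure p} :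
    Tendsto f l (𝓝 μ) ↔ ∀ n, ∀ᶠ i in l, f i - μ ∈ nbhdIdeal p n n := by
  rw [← tendsto_sub_nhds_zero_iff, hasBasis_nhds_zero.tendsto_right_iff]
  simp only [true_imp_iff, SetLike.mem_coe]

theorem hasSum_iUnion_of_approx (f : unifSets p → ℤ_[p])
    (H : ∀ h l : ℕ, ∃ μ : UnifMeasure p, ∀ U : unifSets p, U.1 ∈ unifSetsOfRadius p h →
      (p : ℤ_[p]) ^ l ∣ f U - μ.toFun U) (h : ℕ) (ι : Type) (U : ι → Set ℚ_[p])
    (hU : ∀ i, U i ∈ unifSetsOfRadius p h) (hd : Pairwise fun i j => Disjoint (U i) (U j)) :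
    HasSum (fun i => f ⟨U i, mem_unifSets (hU i)⟩)
      (f ⟨⋃ i, U i, mem_unifSets (iUnion_mem hU)⟩) := by
  refine padicInt_hasSum_iff.2 fun l => ?_
  obtain ⟨μ, hμ⟩ := H h l
  filter_upwards [padicInt_hasSum_iff.1 (μ.hasSum_iUnion h ι U hU hd) l] with s hs
  have hterms : (p : ℤ_[p]) ^ l ∣ ∑ i ∈ s, (f ⟨U i, mem_unifSets (hU i)⟩
    - μ.toFun ⟨U i, mem_unifSets (hU i)⟩) := Finset.dvd_sum fun i _ => hμ _ (hU i)
  have hunion := hμ ⟨⋃ i, U i, mem_unifSets (iUnion_mem hU)⟩ (iUnion_mem hU)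
  rw [Finset.sum_sub_distrib] at hterms
  convert! dvd_sub (dvd_add hterms hs) hunion using 1
  ring

theorem isClosed_range_toUniformOnFunHom :
    IsClosed (range (toUniformOnFunHom : UnifMeasure p → _)) := by
  refine isClosed_of_closure_subset fun f hf => ?_
  have happrox : ∀ h l : ℕ, ∃ μ : UnifMeasure p, ∀ U : unifSets p, U.1 ∈ unifSetsOfRadius p h →
      (p : ℤ_[p]) ^ l ∣ UniformOnFun.toFun _ f U - μ.toFun U := by
    intro h l
    obtain ⟨_, ⟨μ, rfl⟩, hμ⟩ := (mem_closure_iff_nhds_basis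
      (UniformOnFun.hasBasis_nhds_of_basis _ _ (radiusClasses p) f ⟨_, 0, rfl⟩
        directedOn_radiusClasses padicInt_hasBasis_uniformity)).1 hf (_, l) ⟨⟨h, rfl⟩, trivial⟩
    exact ⟨μ, hμ⟩
  exact ⟨⟨_, hasSum_iUnion_of_approx _ happrox⟩, rfl⟩

instance : CompleteSpace (UnifMeasure p) := by
  rw [completeSpace_iff_isComplete_range isUniformInducing_toUniformOnFunHom]
  exact isClosed_range_toUniformOnFunHom.isComplete

end NaturalTopology

section PadicDivisibility

theorem p_pow_mul (n : ℕ) (μ : UnifMeasure p) :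
    (p : UnifMeasure p) ^ n * μ = (p : ℤ_[p]) ^ n • μ := by
  rw [← Nat.cast_pow, ← Nat.cast_pow, Nat.cast_smul_eq_nsmul, nsmul_eq_mul]

theorem p_pow_dvd_iff {n : ℕ} {μ : UnifMeasure p} :
    (p : UnifMeasure p) ^ n ∣ μ ↔ ∀ h, μ ∈ nbhdIdeal p h n := by
  constructor
  · rintro ⟨ν, rfl⟩ h
    rw [p_pow_mul]
    exact smul_mem_nbhdIdeal dvd_rfl h ν
  · intro H
    have hdvd : ∀ U : unifSets p, (p : ℤ_[p]) ^ n ∣ μ.toFun U := by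
      rintro ⟨U, hU⟩
      obtain ⟨h, V, rfl⟩ := mem_iUnion.1 hU
      exact mem_nbhdIdeal_iff_cyl.1 (H h) V
    choose f hf using hdvd
    refine ⟨⟨f, fun h ι U hU hd => padicInt_hasSum_of_pow_mul (k := n) ?_⟩, ?_⟩
    · simpa only [hf] using μ.hasSum_iUnion h ι U hU hd
    · rw [p_pow_mul]
      exact UnifMeasure.ext (funext hf)

theorem eq_zero_of_p_mul_eq_zero {μ : UnifMeasure p} (h : (p : UnifMeasure p) * μ = 0) : μ = 0 := by
  rw [← pow_one (p : UnifMeasure p), p_pow_mul, pow_one] at h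
  refine UnifMeasure.ext (funext fun U => ?_)
  have hU : (p : ℤ_[p]) * μ.toFun U = 0 := congrFun (congrArg UnifMeasure.toFun h) U
  exact (mul_eq_zero.1 hU).resolve_left PadicInt.prime_p.ne_zero

theorem eq_zero_of_forall_p_pow_dvd {μ : UnifMeasure p}
    (h : ∀ n : ℕ, (p : UnifMeasure p) ^ n ∣ μ) : μ = 0 :=
  eq_zero_of_forall_mem_nbhdIdeal fun n => p_pow_dvd_iff.1 (h n) n

instance : ContinuousSMul ℤ_[p] (UnifMeasure p) := by
  refine continuousSMul_of_algebraMap _ _ (continuous_of_continuousAt_zero _ ?_)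
  rw [ContinuousAt, map_zero]
  refine (padicInt_hasBasis_nhds_zero.tendsto_iff hasBasis_nhds_zero).2 fun n _ =>
    ⟨n, trivial, fun a ha => ?_⟩
  rw [Algebra.algebraMap_eq_smul_one]
  exact smul_mem_nbhdIdeal ha n 1

end PadicDivisibility

section Dirac

theorem dirac_cyl (x : ℚ_[p]) (h : ℕ) (V : Set (Balls p h)) [Decidable (proj p h x ∈ V)] :
    (dirac x).toFun (cyl h V) = if proj p h x ∈ V then 1 else 0 := by
  simp only [dirac, cyl, mem_preimage]

theorem dirac_ball (x : ℚ_[p]) (h : ℕ) (c : Balls p h) [Decidable (proj p h x = c)] :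
    (dirac x).ball h c = if proj p h x = c then 1 else 0 := by
  classical
  rw [UnifMeasure.ball, dirac_cyl]
  congr 1

theorem dirac_zero : dirac (0 : ℚ_[p]) = 1 := rfl

theorem dirac_mul (x y : ℚ_[p]) : dirac x * dirac y = dirac (x + y) := by
  classical
  refine ext_cyl fun h V => (hasSum_mul (dirac x) (dirac y) h V).unique ?_
  have hsum := hasSum_single (f := {c : Balls p h × Balls p h | c.1 + c.2 ∈ V}.indicator
    fun c => (dirac x).ball h c.1 * (dirac y).ball h c.2) (proj p h x, proj p h y) fun c hc => ?_
  · convert! hsum using 1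
    simp only [dirac_cyl, dirac_ball, indicator_apply, mem_ofPred_eq, if_true, mul_one]
    rfl
  · rw [indicator_apply, dirac_ball, dirac_ball]
    split_ifs with _ hx hy
    · exact absurd (Prod.ext hx.symm hy.symm) hc
    all_goals simp

theorem dirac_pow (x : ℚ_[p]) (n : ℕ) : dirac x ^ n = dirac ((n : ℚ_[p]) * x) := by
  induction n with
  | zero => simp [dirac_zero]
  | succ n ih => rw [pow_succ, ih, dirac_mul, Nat.cast_succ, add_one_mul]

theorem proj_eq_iff {h : ℕ} {x y : ℚ_[p]} :
    proj p h x = proj p h y ↔ ‖x - y‖ ≤ (p : ℝ) ^ (-(h : ℤ)) := by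
  rw [← sub_eq_zero]
  exact QuotientAddGroup.eq_zero_iff (x - y)

theorem dirac_sub_dirac_mem {x y : ℚ_[p]} {h : ℕ} (hxy : proj p h x = proj p h y) (l : ℕ) :
    dirac x - dirac y ∈ nbhdIdeal p h l := fun c => by
  classical
  simp only [sub_ball, dirac_ball, hxy, sub_self, dvd_zero]

end Dirac

section RootsOfT

theorem dirac_eq_one_add_T (n : ℕ) : dirac (1 / (p : ℚ_[p]) ^ n) = 1 + T p n := by
  rw [T, dirac_zero, add_sub_cancel]

theorem dirac_inv_pow_add_pow (n m : ℕ) :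
    dirac (1 / (p : ℚ_[p]) ^ (n + m)) ^ p ^ m = dirac (1 / (p : ℚ_[p]) ^ n) := by
  have hp : (p : ℚ_[p]) ≠ 0 := NeZero.ne _
  rw [dirac_pow, Nat.cast_pow, pow_add]
  congr 1
  field_simp

theorem p_dvd_T_pow_sub (n k : ℕ) :
    (p : UnifMeasure p) ∣ T p n ^ p ^ k - (dirac (1 / (p : ℚ_[p]) ^ n) ^ p ^ k - 1) := by
  obtain ⟨r, hr⟩ := exists_add_pow_prime_pow_eq (Fact.out : p.Prime) 1 (T p n) k
  exact ⟨-(1 * T p n * r), by rw [dirac_eq_one_add_T, hr, one_pow]; ring⟩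

theorem p_dvd_T_succ_pow_sub (n : ℕ) : (p : UnifMeasure p) ∣ T p (n + 1) ^ p - T p n := by
  have hdvd := p_dvd_T_pow_sub (p := p) (n + 1) 1
  rwa [dirac_inv_pow_add_pow, pow_one] at hdvd

theorem p_pow_dvd_T_succ_pow_sub (n m : ℕ) :
    (p : UnifMeasure p) ^ (m + 1) ∣ T p (n + (m + 1)) ^ p ^ (m + 1) - T p (n + m) ^ p ^ m := by
  have hdvd := dvd_sub_pow_of_dvd_sub (p_dvd_T_succ_pow_sub (p := p) (n + m)) m
  rwa [← pow_mul, ← pow_succ'] at hdvd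

theorem p_pow_dvd_T_pow_sub_T_pow (n : ℕ) {m k : ℕ} (hmk : m ≤ k) :
    (p : UnifMeasure p) ^ (m + 1) ∣ T p (n + k) ^ p ^ k - T p (n + m) ^ p ^ m := by
  induction k, hmk using Nat.le_induction with
  | base => simp
  | succ k hmk ih =>
    rw [← sub_add_sub_cancel]
    exact dvd_add ((pow_dvd_pow _ (by omega)).trans (p_pow_dvd_T_succ_pow_sub n k)) ih

theorem exists_p_pow_dvd_T_pow_sub (n : ℕ) :
    ∃ μ : UnifMeasure p, ∀ m, (p : UnifMeasure p) ^ (m + 1) ∣ T p (n + m) ^ p ^ m - μ := by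
  have hcauchy : CauchySeq fun m => T p (n + m) ^ p ^ m := by
    refine hasBasis_uniformity.cauchySeq_iff'.2 fun k _ => ⟨k, fun m hm => ?_⟩
    exact nbhdIdeal_anti le_rfl (Nat.le_succ k)
      (p_pow_dvd_iff.1 (dvd_sub_comm.1 (p_pow_dvd_T_pow_sub_T_pow n hm)) k)
  obtain ⟨μ, hμ⟩ := cauchySeq_tendsto_of_complete hcauchy
  refine ⟨μ, fun m => p_pow_dvd_iff.2 fun h => ?_⟩
  refine (isClosed_nbhdIdeal h (m + 1)).mem_of_tendsto (hμ.const_sub (T p (n + m) ^ p ^ m)) ?_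
  filter_upwards [eventually_ge_atTop m] with i hi
  exact p_pow_dvd_iff.1 (dvd_sub_comm.1 (p_pow_dvd_T_pow_sub_T_pow n hi)) h

theorem pAdic_tendsto_iff {ι : Type*} {l : Filter ι} {f : ι → UnifMeasure p} {μ : UnifMeasure p} :
    Tendsto f l (@nhds _ (pAdicTopology p) μ) ↔
      ∀ k : ℕ, ∀ᶠ i in l, (p : UnifMeasure p) ^ k ∣ f i - μ := by
  rw [((Ideal.span {(p : UnifMeasure p)}).hasBasis_nhds_adic μ).tendsto_right_iff]
  simp only [true_imp_iff, Ideal.span_singleton_pow, image_add_left, mem_preimage, SetLike.mem_coe,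
    Ideal.mem_span_singleton, neg_add_eq_sub]

theorem tendsto_tT (n : ℕ) : Tendsto (fun m : ℕ => T p (n + m) ^ p ^ m) atTop
    (@nhds _ (pAdicTopology p) (tT p n)) := by
  obtain ⟨μ, hμ⟩ := exists_p_pow_dvd_T_pow_sub (p := p) n
  refine @tendsto_nhds_limUnder _ _ (pAdicTopology p) _ _ ⟨μ, pAdic_tendsto_iff.2 fun k => ?_⟩
  filter_upwards [eventually_ge_atTop k] with m hm
  exact (pow_dvd_pow _ (by omega)).trans (hμ m)

theorem p_pow_dvd_T_pow_sub_tT (n m : ℕ) :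
    (p : UnifMeasure p) ^ (m + 1) ∣ T p (n + m) ^ p ^ m - tT p n := by
  obtain ⟨i, hi, him⟩ := ((pAdic_tendsto_iff.1 (tendsto_tT (p := p) n) (m + 1)).and
    (eventually_ge_atTop m)).exists
  simpa only [sub_sub_sub_cancel_left] using dvd_sub hi (p_pow_dvd_T_pow_sub_T_pow n him)

theorem p_dvd_tT_sub_T (n : ℕ) : (p : UnifMeasure p) ∣ tT p n - T p n := by
  simpa using dvd_sub_comm.1 (p_pow_dvd_T_pow_sub_tT (p := p) n 0)

theorem tT_succ_pow (n : ℕ) : tT p (n + 1) ^ p = tT p n := by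
  refine sub_eq_zero.1 (eq_zero_of_forall_p_pow_dvd fun m => ?_)
  have hroot : (p : UnifMeasure p) ^ (m + 1) ∣
      T p (n + (m + 1)) ^ p ^ (m + 1) - tT p (n + 1) ^ p := by
    have hdvd := (p_pow_dvd_T_pow_sub_tT (p := p) (n + 1) m).trans (sub_dvd_pow_sub_pow _ _ p)
    rwa [← pow_mul, ← pow_succ, add_assoc, add_comm 1 m] at hdvd
  refine (pow_dvd_pow _ (Nat.le_succ m)).trans ?_
  convert! dvd_sub ((pow_dvd_pow _ (Nat.le_succ (m + 1))).trans
    (p_pow_dvd_T_pow_sub_tT (p := p) n (m + 1))) hroot using 1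
  ring

theorem tT_add_pow (n k : ℕ) : tT p (n + k) ^ p ^ k = tT p n := by
  induction k with
  | zero => simp
  | succ k ih => rw [pow_succ', pow_mul, ← add_assoc, tT_succ_pow, ih]

end RootsOfT

section FractionalPowers

theorem S_nonneg (q : S p) : (0 : ℝ) ≤ q := by
  obtain ⟨q, m, n, rfl⟩ := q
  positivity

theorem tPow_eq (m n : ℕ) (q : S p) (hq : (q : ℝ) = m / (p : ℝ) ^ n) : tPow q = tT p n ^ m := by
  have hspec := q.2.choose_spec.choose_spec
  unfold tPow
  generalize q.2.choose_spec.choose = n' at *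
  generalize q.2.choose = m' at *
  have hp : (p : ℝ) ≠ 0 := NeZero.ne _
  have hcross : p ^ n * m' = m * p ^ n' := by
    rw [hq] at hspec
    field_simp at hspec
    exact_mod_cast hspec.symm
  rw [← tT_add_pow n' n, ← tT_add_pow n n', ← pow_mul, ← pow_mul, add_comm n' n, hcross,
    mul_comm]

/-- The element `i / p ^ n` of `S`; every element of `S` is of this form for all large `n`. -/
def sFrac (p : ℕ) [Fact p.Prime] (n i : ℕ) : S p := ⟨i / (p : ℝ) ^ n, i, n, rfl⟩

theorem coe_sFrac (n i : ℕ) : (sFrac p n i : ℝ) = i / (p : ℝ) ^ n := rfl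

theorem tPow_sFrac (n i : ℕ) : tPow (sFrac p n i) = tT p n ^ i := tPow_eq i n _ rfl

theorem sFrac_injective (n : ℕ) : Function.Injective (sFrac p n) := fun i j hij => by
  have hp : (p : ℝ) ≠ 0 := NeZero.ne _
  have hval : (i / (p : ℝ) ^ n) = j / (p : ℝ) ^ n := congrArg (Subtype.val : S p → ℝ) hij
  field_simp at hval
  exact_mod_cast hval

theorem sFrac_add (n i j : ℕ) : sFrac p n (i + j) = sFrac p n i + sFrac p n j :=
  Subtype.ext <| by
    rw [AddSubmonoid.coe_add, coe_sFrac, coe_sFrac, coe_sFrac, Nat.cast_add, add_div]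

theorem eventually_exists_eq_sFrac (q : S p) : ∀ᶠ n in atTop, ∃ i, q = sFrac p n i := by
  obtain ⟨q, m, n, rfl⟩ := q
  filter_upwards [eventually_ge_atTop n] with k hk
  obtain ⟨j, rfl⟩ := Nat.exists_eq_add_of_le hk
  have hp : (p : ℝ) ≠ 0 := NeZero.ne _
  refine ⟨m * p ^ j, Subtype.ext ?_⟩
  rw [coe_sFrac, Nat.cast_mul, Nat.cast_pow, pow_add]
  field_simp

theorem exists_eq_sFrac_sFrac (q r : S p) : ∃ n i j, q = sFrac p n i ∧ r = sFrac p n j := by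
  obtain ⟨n, ⟨i, hi⟩, j, hj⟩ :=
    ((eventually_exists_eq_sFrac q).and (eventually_exists_eq_sFrac r)).exists
  exact ⟨n, i, j, hi, hj⟩

theorem tPow_zero : tPow (0 : S p) = 1 := by
  rw [tPow_eq 0 0 _ (by simp), pow_zero]

theorem tPow_add (q r : S p) : tPow (q + r) = tPow q * tPow r := by
  obtain ⟨n, i, j, rfl, rfl⟩ := exists_eq_sFrac_sFrac q r
  rw [← sFrac_add, tPow_sFrac, tPow_sFrac, tPow_sFrac, pow_add]

theorem exists_add_eq {q r : S p} (h : (r : ℝ) ≤ q) : ∃ s : S p, r + s = q := by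
  obtain ⟨n, i, j, rfl, rfl⟩ := exists_eq_sFrac_sFrac q r
  have hp : (0 : ℝ) < p := Nat.cast_pos.2 (NeZero.pos p)
  rw [coe_sFrac, coe_sFrac, div_le_div_iff_of_pos_right (by positivity), Nat.cast_le] at h
  obtain ⟨k, rfl⟩ := Nat.exists_eq_add_of_le h
  exact ⟨sFrac p n k, (sFrac_add n j k).symm⟩

theorem tT_zero_pow_mem_nbhdIdeal (h : ℕ) : tT p 0 ^ p ^ h ∈ nbhdIdeal p h 1 := by
  have hdirac : dirac (1 / (p : ℚ_[p]) ^ 0) ^ p ^ h - 1 ∈ nbhdIdeal p h 1 := by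
    rw [dirac_pow, ← dirac_zero]
    refine dirac_sub_dirac_mem (proj_eq_iff.2 ?_) 1
    simp
  have hdvd := dvd_add ((p_dvd_tT_sub_T (p := p) 0).trans (sub_dvd_pow_sub_pow _ _ (p ^ h)))
    (p_dvd_T_pow_sub (p := p) 0 h)
  rw [sub_add_sub_cancel, ← pow_one (p : UnifMeasure p)] at hdvd
  simpa only [sub_add_cancel] using add_mem (p_pow_dvd_iff.1 hdvd h) hdirac

theorem tPow_mem_nbhdIdeal {h l : ℕ} {q : S p} (hq : (l * p ^ h : ℝ) ≤ q) :
    tPow q ∈ nbhdIdeal p h l := by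
  obtain ⟨s, rfl⟩ := exists_add_eq (r := sFrac p 0 (p ^ h * l)) (q := q) (by
    simpa [coe_sFrac, mul_comm] using hq)
  rw [tPow_add, tPow_sFrac, pow_mul]
  refine Ideal.mul_mem_right _ _ ?_
  simpa using pow_mem_nbhdIdeal (tT_zero_pow_mem_nbhdIdeal (p := p) h) l

end FractionalPowers

section Weight

theorem vp_of_ne_zero {a : ℤ_[p]} (ha : a ≠ 0) : vp a = ((a.valuation : ℝ) : WithTop ℝ) :=
  if_neg ha

@[simp]
theorem vp_zero : vp (0 : ℤ_[p]) = ⊤ := if_pos rfl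

theorem le_vp_iff {C : ℝ} {a : ℤ_[p]} : (C : WithTop ℝ) ≤ vp a ↔ (p : ℤ_[p]) ^ ⌈C⌉₊ ∣ a := by
  by_cases ha : a = 0
  · simp [ha]
  · rw [vp_of_ne_zero ha, WithTop.coe_le_coe, ← Nat.ceil_le, ← Ideal.mem_span_singleton,
      PadicInt.mem_span_pow_iff_le_valuation a ha]

theorem vp_mul (a b : ℤ_[p]) : vp (a * b) = vp a + vp b := by
  by_cases ha : a = 0
  · simp [ha]
  by_cases hb : b = 0
  · simp [hb]
  rw [vp_of_ne_zero ha, vp_of_ne_zero hb, vp_of_ne_zero (mul_ne_zero ha hb),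
    PadicInt.valuation_mul ha hb, ← WithTop.coe_add, Nat.cast_add]

theorem weight_mul (a b : ℤ_[p]) (q r : S p) :
    weight (a * b) (q + r) = weight a q + weight b r := by
  rw [weight, weight, weight, vp_mul, AddSubmonoid.coe_add, WithTop.coe_add, add_add_add_comm]

@[simp]
theorem weight_zero (q : S p) : weight 0 q = ⊤ := by simp [weight]

theorem weight_of_ne_zero {a : ℤ_[p]} (ha : a ≠ 0) (q : S p) :
    weight a q = ((a.valuation + q : ℝ) : WithTop ℝ) := by
  rw [weight, vp_of_ne_zero ha, WithTop.coe_add]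

theorem le_weight_iff {C : ℝ} {a : ℤ_[p]} {q : S p} :
    (C : WithTop ℝ) ≤ weight a q ↔ (p : ℤ_[p]) ^ ⌈C - q⌉₊ ∣ a := by
  rw [← le_vp_iff, weight]
  cases vp a with
  | top => simp
  | coe v => rw [← WithTop.coe_add, WithTop.coe_le_coe, WithTop.coe_le_coe, sub_le_iff_le_add]

theorem zero_le_weight (a : ℤ_[p]) (q : S p) : ((0 : ℝ) : WithTop ℝ) ≤ weight a q :=
  le_weight_iff.2 (by rw [Nat.ceil_eq_zero.2 (by linarith [S_nonneg q]), pow_zero]; exact one_dvd _)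

theorem smul_tPow_mem_nbhdIdeal {h l : ℕ} {a : ℤ_[p]} {q : S p}
    (H : ((l * p ^ h + l : ℝ) : WithTop ℝ) ≤ weight a q) : a • tPow q ∈ nbhdIdeal p h l := by
  by_cases hq : (l * p ^ h : ℝ) ≤ q
  · exact Submodule.smul_of_tower_mem _ a (tPow_mem_nbhdIdeal hq)
  · refine smul_mem_nbhdIdeal ((pow_dvd_pow _ ?_).trans (le_weight_iff.1 H)) h _
    have hceil : (l : ℝ) ≤ ⌈(l * p ^ h + l : ℝ) - q⌉₊ := le_trans (by linarith) (Nat.le_ceil _)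
    exact_mod_cast hceil

end Weight

section WeightClosure

/-- The finite sums of terms `a T̃ ^ q` of weight at least `C`: for each `q` these terms are the
multiples of `p ^ ⌈C - q⌉₊ T̃ ^ q`. -/
def finiteSums (p : ℕ) [Fact p.Prime] (C : ℝ) : Submodule ℤ_[p] (UnifMeasure p) :=
  Submodule.span ℤ_[p] (range fun q : S p => (p : ℤ_[p]) ^ ⌈C - q⌉₊ • tPow q)

/-- The closure of the finite sums of terms `a T̃ ^ q` of weight at least `C`. It turns out to be
the set of the measures `μ` with `w(μ) ≥ C`. -/
def weightClosure (p : ℕ) [Fact p.Prime] (C : ℝ) : Submodule ℤ_[p] (UnifMeasure p) :=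
  (finiteSums p C).topologicalClosure

theorem smul_tPow_mem_finiteSums {C : ℝ} {a : ℤ_[p]} {q : S p}
    (h : (C : WithTop ℝ) ≤ weight a q) : a • tPow q ∈ finiteSums p C := by
  obtain ⟨b, rfl⟩ := le_weight_iff.1 h
  rw [mul_comm, mul_smul]
  exact Submodule.smul_mem _ b (Submodule.subset_span (mem_range_self q))

theorem exists_finsupp_of_mem_finiteSums {C : ℝ} {x : UnifMeasure p} (hx : x ∈ finiteSums p C) :
    ∃ a : S p →₀ ℤ_[p], (∀ q, (C : WithTop ℝ) ≤ weight (a q) q) ∧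
      a.sum (fun q c => c • tPow q) = x := by
  obtain ⟨c, rfl⟩ := Finsupp.mem_span_range_iff_exists_finsupp.1 hx
  refine ⟨Finsupp.onFinset c.support (fun q => c q * (p : ℤ_[p]) ^ ⌈C - q⌉₊) fun q hq =>
    Finsupp.mem_support_iff.2 (left_ne_zero_of_mul hq), fun q => ?_, ?_⟩
  · exact le_weight_iff.2 (Dvd.intro_left (c q) rfl)
  · rw [Finsupp.onFinset_sum _ fun q => zero_smul _ (tPow q)]
    exact Finset.sum_congr rfl fun q _ => mul_smul _ _ _

theorem finiteSums_le_weightClosure (C : ℝ) : finiteSums p C ≤ weightClosure p C :=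
  Submodule.le_topologicalClosure _

theorem isClosed_weightClosure (C : ℝ) : IsClosed (weightClosure p C : Set (UnifMeasure p)) :=
  Submodule.isClosed_topologicalClosure _

theorem mul_mem_finiteSums {C C' : ℝ} {x y : UnifMeasure p} (hx : x ∈ finiteSums p C)
    (hy : y ∈ finiteSums p C') : x * y ∈ finiteSums p (C + C') := by
  refine (?_ : finiteSums p C * finiteSums p C' ≤ finiteSums p (C + C'))
    (Submodule.mul_mem_mul hx hy)
  rw [finiteSums, finiteSums, Submodule.span_mul_span, Submodule.span_le]
  rintro _ ⟨_, ⟨q, rfl⟩, _, ⟨r, rfl⟩, rfl⟩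
  beta_reduce
  rw [smul_mul_smul_comm, ← tPow_add]
  refine smul_tPow_mem_finiteSums ?_
  rw [weight_mul, WithTop.coe_add]
  exact add_le_add (le_weight_iff.2 dvd_rfl) (le_weight_iff.2 dvd_rfl)

theorem mul_mem_weightClosure {C C' : ℝ} {x y : UnifMeasure p} (hx : x ∈ weightClosure p C)
    (hy : y ∈ weightClosure p C') : x * y ∈ weightClosure p (C + C') :=
  map_mem_closure₂ continuous_mul hx hy fun _ ha _ hb => mul_mem_finiteSums ha hb

theorem mem_closure_iff_forall_sub_mem {s : Set (UnifMeasure p)} {x : UnifMeasure p} :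
    x ∈ closure s ↔ ∀ n, ∃ y ∈ s, x - y ∈ nbhdIdeal p n n := by
  rw [mem_closure_iff_nhds_basis (nhds_basis_uniformity hasBasis_uniformity)]
  simp only [true_imp_iff, mem_ofPred_eq]

theorem mem_weightClosure_iff {C : ℝ} {x : UnifMeasure p} :
    x ∈ weightClosure p C ↔ ∀ n, ∃ y ∈ finiteSums p C, x - y ∈ nbhdIdeal p n n :=
  mem_closure_iff_forall_sub_mem

theorem tPow_mem_finiteSums_zero (q : S p) : tPow q ∈ finiteSums p 0 := by
  rw [← one_smul ℤ_[p] (tPow q)]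
  exact smul_tPow_mem_finiteSums (zero_le_weight _ _)

theorem one_mem_finiteSums_zero : 1 ∈ finiteSums p 0 :=
  tPow_zero (p := p) ▸ tPow_mem_finiteSums_zero 0

theorem one_add_tT_pow_mem_finiteSums_zero (m k : ℕ) : (1 + tT p m) ^ k ∈ finiteSums p 0 := by
  have htT : tT p m ∈ finiteSums p 0 := by
    rw [← pow_one (tT p m), ← tPow_sFrac]
    exact tPow_mem_finiteSums_zero _
  induction k with
  | zero => simpa only [pow_zero] using one_mem_finiteSums_zero
  | succ k ih =>
    rw [pow_succ]
    simpa only [add_zero] using mul_mem_finiteSums ih (add_mem one_mem_finiteSums_zero htT)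

end WeightClosure

section DiracExpansion

theorem factorization_sub_le_div {p : ℕ} (hp : p.Prime) (m : ℕ) {i : ℕ} (hi : i ≠ 0) :
    (i.factorization p : ℝ) - m ≤ i / (p : ℝ) ^ m := by
  have hp0 : (0 : ℝ) < p := Nat.cast_pos.2 hp.pos
  rcases le_total (i.factorization p) m with hle | hge
  · exact (sub_nonpos.2 (Nat.cast_le.2 hle)).trans (by positivity)
  · obtain ⟨t, ht⟩ := Nat.exists_eq_add_of_le hge
    have hmul : t * p ^ m ≤ i :=
      calc t * p ^ m ≤ p ^ t * p ^ m := Nat.mul_le_mul_right _ (Nat.lt_pow_self hp.one_lt).le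
        _ = p ^ i.factorization p := by rw [ht, pow_add, mul_comm]
        _ ≤ i := Nat.ordProj_le p hi
    rw [le_div_iff₀ (by positivity), ht, Nat.cast_add, add_sub_cancel_left]
    exact_mod_cast hmul

theorem le_weight_choose (m n : ℕ) {i : ℕ} (hi : i ≠ 0) (him : i ≤ p ^ (m + n)) :
    ((n : ℝ) : WithTop ℝ) ≤ weight (((p ^ (m + n)).choose i : ℕ) : ℤ_[p]) (sFrac p m i) := by
  have hp : p.Prime := Fact.out
  have hdvd : (p : ℤ_[p]) ^ ((p ^ (m + n)).choose i).factorization p ∣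
      ((p ^ (m + n)).choose i : ℕ) := by
    exact_mod_cast Nat.cast_dvd_cast (α := ℤ_[p]) (Nat.ordProj_dvd _ p)
  refine le_weight_iff.2 ((pow_dvd_pow _ ?_).trans hdvd)
  have hsum : (((p ^ (m + n)).choose i).factorization p : ℝ) + i.factorization p = m + n := by
    exact_mod_cast Nat.factorization_choose_prime_pow_add_factorization hp him hi
  have hfrac := factorization_sub_le_div hp m hi
  rw [Nat.ceil_le, coe_sFrac]
  linarith

theorem one_add_tT_pow_sub_one_mem (m n : ℕ) :
    (1 + tT p m) ^ p ^ (m + n) - 1 ∈ finiteSums p n := by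
  rw [add_comm, add_pow, Finset.sum_range_succ']
  simp only [one_pow, mul_one, pow_zero, Nat.choose_zero_right, Nat.cast_one, add_sub_cancel_right]
  refine sum_mem fun i hi => ?_
  rw [mul_comm, ← nsmul_eq_mul, ← Nat.cast_smul_eq_nsmul ℤ_[p], ← tPow_sFrac]
  exact smul_tPow_mem_finiteSums
    (le_weight_choose m n i.succ_ne_zero (Finset.mem_range.1 hi))

theorem dirac_inv_pow_sub_mem_nbhdIdeal (m k h : ℕ) :
    dirac (1 / (p : ℚ_[p]) ^ m) ^ p ^ k - (1 + tT p m) ^ p ^ k ∈ nbhdIdeal p h (k + 1) := by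
  refine p_pow_dvd_iff.1 (dvd_sub_pow_of_dvd_sub ?_ k) h
  rw [dirac_eq_one_add_T, add_sub_add_left_eq_sub]
  exact dvd_sub_comm.1 (p_dvd_tT_sub_T m)

theorem dirac_p_pow_sub_one_mem (n : ℕ) : dirac ((p : ℚ_[p]) ^ n) - 1 ∈ weightClosure p n := by
  refine mem_weightClosure_iff.2 fun k => ⟨_, one_add_tT_pow_sub_one_mem k n, ?_⟩
  have hdirac : dirac (1 / (p : ℚ_[p]) ^ k) ^ p ^ (k + n) = dirac ((p : ℚ_[p]) ^ n) := by
    have hp : (p : ℚ_[p]) ≠ 0 := NeZero.ne _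
    rw [dirac_pow, Nat.cast_pow, pow_add, mul_one_div, mul_div_cancel_left₀ _ (pow_ne_zero k hp)]
  rw [sub_sub_sub_cancel_right, ← hdirac]
  exact nbhdIdeal_anti le_rfl (by omega) (dirac_inv_pow_sub_mem_nbhdIdeal k (k + n) k)

theorem dirac_inv_pow_mem (j : ℕ) : dirac (1 / (p : ℚ_[p]) ^ j) ∈ weightClosure p 0 := by
  refine mem_weightClosure_iff.2 fun k =>
    ⟨_, one_add_tT_pow_mem_finiteSums_zero (j + k) (p ^ k), ?_⟩
  rw [← dirac_inv_pow_add_pow j k]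
  exact nbhdIdeal_anti le_rfl (Nat.le_succ k) (dirac_inv_pow_sub_mem_nbhdIdeal (j + k) k k)

theorem continuous_dirac : Continuous (dirac : ℚ_[p] → UnifMeasure p) := by
  refine continuous_iff_continuousAt.2 fun x => tendsto_iff_eventually_sub_mem.2 fun n => ?_
  have hp0 : (0 : ℝ) < p := Nat.cast_pos.2 (NeZero.pos p)
  filter_upwards [Metric.closedBall_mem_nhds x (show 0 < (p : ℝ) ^ (-(n : ℤ)) by positivity)]
    with y hy
  exact dirac_sub_dirac_mem (proj_eq_iff.2 (mem_closedBall_iff_norm.1 hy)) n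

theorem dirac_padicInt_mul_mem {s : Set (UnifMeasure p)} (hs : IsClosed s) {x : ℚ_[p]}
    (hpow : ∀ m : ℕ, dirac x ^ m ∈ s) (z : ℤ_[p]) : dirac ((z : ℚ_[p]) * x) ∈ s := by
  have hcont : Continuous fun z : ℤ_[p] => dirac ((z : ℚ_[p]) * x) :=
    continuous_dirac.comp (continuous_subtype_val.mul continuous_const)
  refine PadicInt.denseRange_natCast.induction_on z (hs.preimage hcont) fun m => ?_
  rw [PadicInt.coe_natCast, ← dirac_pow]
  exact hpow m

theorem exists_padicInt_mul_pow {x : ℚ_[p]} {n : ℤ} (hx : ‖x‖ ≤ (p : ℝ) ^ (-n)) :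
    ∃ z : ℤ_[p], x = z * (p : ℚ_[p]) ^ n := by
  have hp0 : (0 : ℝ) < p := Nat.cast_pos.2 (NeZero.pos p)
  have hp : (p : ℚ_[p]) ≠ 0 := NeZero.ne _
  refine ⟨⟨x / (p : ℚ_[p]) ^ n, ?_⟩, (div_mul_cancel₀ _ (zpow_ne_zero n hp)).symm⟩
  rw [norm_div, Padic.norm_p_zpow]
  exact (div_le_one (by positivity)).2 hx

theorem dirac_mem_weightClosure_zero (x : ℚ_[p]) : dirac x ∈ weightClosure p 0 := by
  have hp1 : (1 : ℝ) < p := Nat.one_lt_cast.2 (Fact.out : p.Prime).one_lt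
  obtain ⟨j, hj⟩ := pow_unbounded_of_one_lt ‖x‖ hp1
  obtain ⟨z, rfl⟩ := exists_padicInt_mul_pow (x := x) (n := -j) (by simpa using hj.le)
  rw [zpow_neg, zpow_natCast, ← one_div]
  refine dirac_padicInt_mul_mem (isClosed_weightClosure 0) (fun m => ?_) z
  induction m with
  | zero =>
    rw [pow_zero]
    exact finiteSums_le_weightClosure 0 one_mem_finiteSums_zero
  | succ m ih =>
    rw [pow_succ]
    simpa only [add_zero, SetLike.mem_coe] using mul_mem_weightClosure ih (dirac_inv_pow_mem j)

theorem ball_sum_smul {ι : Type*} (s : Finset ι) (a : ι → ℤ_[p]) (μ : ι → UnifMeasure p) (h : ℕ)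
    (c : Balls p h) : (∑ i ∈ s, a i • μ i).ball h c = ∑ i ∈ s, a i * (μ i).ball h c := by
  classical
  induction s using Finset.induction_on with
  | empty => simp only [Finset.sum_empty]; rfl
  | insert i s hi ih => rw [Finset.sum_insert hi, Finset.sum_insert hi, ← ih]; rfl

theorem proj_out {h : ℕ} (c : Balls p h) : proj p h (Quotient.out c) = c := Quotient.out_eq c

theorem exists_sub_sum_dirac_mem (μ : UnifMeasure p) (n : ℕ) : ∃ s : Finset (Balls p n),
    μ - ∑ c ∈ s, μ.ball n c • dirac (Quotient.out c : ℚ_[p]) ∈ nbhdIdeal p n n := by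
  have hfin := (padicInt_hasBasis_nhds_zero.tendsto_right_iff.1
    (μ.hasSum_ball n).summable.tendsto_cofinite_zero) n trivial
  refine ⟨(eventually_cofinite.1 hfin).toFinset, fun c => ?_⟩
  classical
  rw [sub_ball, ball_sum_smul]
  simp only [dirac_ball, proj_out, mul_ite, mul_one, mul_zero, Finset.sum_ite_eq',
    Finite.mem_toFinset]
  split_ifs with hc
  · simp
  · simpa using hc

theorem weightClosure_zero : weightClosure p 0 = ⊤ := by
  refine eq_top_iff.2 fun μ _ => ?_
  rw [← SetLike.mem_coe, ← (isClosed_weightClosure 0).closure_eq, mem_closure_iff_forall_sub_mem]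
  intro n
  obtain ⟨s, hs⟩ := exists_sub_sum_dirac_mem μ n
  exact ⟨_, sum_mem fun c _ => Submodule.smul_mem _ _ (dirac_mem_weightClosure_zero _), hs⟩

theorem mul_mem_weightClosure_right {C : ℝ} {x : UnifMeasure p} (hx : x ∈ weightClosure p C)
    (y : UnifMeasure p) : x * y ∈ weightClosure p C := by
  have hy : y ∈ weightClosure p 0 := weightClosure_zero (p := p) ▸ Submodule.mem_top
  simpa only [add_zero] using mul_mem_weightClosure hx hy

theorem dirac_sub_dirac_mem_weightClosure {n : ℕ} {x y : ℚ_[p]} (h : proj p n x = proj p n y) :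
    dirac x - dirac y ∈ weightClosure p n := by
  obtain ⟨z, hz⟩ := exists_padicInt_mul_pow (n := n) (proj_eq_iff.1 h)
  have hmem : dirac ((z : ℚ_[p]) * (p : ℚ_[p]) ^ n) - 1 ∈ weightClosure p n := by
    refine dirac_padicInt_mul_mem (s := (· - 1) ⁻¹' (weightClosure p n : Set (UnifMeasure p)))
      ((isClosed_weightClosure _).preimage (continuous_sub_right 1)) (fun m => ?_) z
    obtain ⟨r, hr⟩ := sub_one_dvd_pow_sub_one (dirac ((p : ℚ_[p]) ^ n)) m
    simpa only [mem_preimage, SetLike.mem_coe, hr] using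
      mul_mem_weightClosure_right (dirac_p_pow_sub_one_mem n) r
  have hmul := mul_mem_weightClosure_right hmem (dirac y)
  rwa [sub_mul, one_mul, dirac_mul, ← zpow_natCast, ← hz, sub_add_cancel] at hmul

theorem smul_mem_weightClosure_of_dvd {n : ℕ} {a : ℤ_[p]} (ha : (p : ℤ_[p]) ^ n ∣ a)
    (x : UnifMeasure p) : a • x ∈ weightClosure p n := by
  have hone : a • (1 : UnifMeasure p) ∈ weightClosure p n := by
    rw [← tPow_zero]
    exact finiteSums_le_weightClosure _ (smul_tPow_mem_finiteSums (le_weight_iff.2 (by simpa)))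
  simpa only [smul_mul_assoc, one_mul] using mul_mem_weightClosure_right hone x

theorem sum_smul_dirac_mem_weightClosure {ι : Type*} {n : ℕ} {s : Finset ι} {a : ι → ℤ_[p]}
    {x : ι → ℚ_[p]} (hmem : ∑ i ∈ s, a i • dirac (x i) ∈ nbhdIdeal p n n) :
    ∑ i ∈ s, a i • dirac (x i) ∈ weightClosure p n := by
  classical
  let rep : Balls p n → ℚ_[p] := Quotient.out
  have hdiff : ∑ i ∈ s, a i • (dirac (x i) - dirac (rep (proj p n (x i)))) ∈
      weightClosure p n := sum_mem fun i _ =>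
    Submodule.smul_mem _ _ (dirac_sub_dirac_mem_weightClosure (proj_out _).symm)
  have hrep : ∑ i ∈ s, a i • dirac (rep (proj p n (x i))) ∈ weightClosure p n := by
    rw [← Finset.sum_fiberwise_of_maps_to fun i hi =>
      Finset.mem_image_of_mem (fun i => proj p n (x i)) hi]
    refine sum_mem fun d _ => ?_
    rw [Finset.sum_congr rfl (g := fun i => a i • dirac (rep d)) fun i hi => by
      rw [(Finset.mem_filter.1 hi).2], ← Finset.sum_smul]
    refine smul_mem_weightClosure_of_dvd ?_ _
    have hball := hmem d
    rw [ball_sum_smul] at hball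
    simpa only [dirac_ball, mul_ite, mul_one, mul_zero, ← Finset.sum_filter] using hball
  simpa only [← Finset.sum_add_distrib, ← smul_add, sub_add_cancel] using add_mem hdiff hrep

theorem mem_weightClosure_of_mem_nbhdIdeal {n : ℕ} {μ : UnifMeasure p}
    (hμ : μ ∈ nbhdIdeal p n n) : μ ∈ weightClosure p n := by
  rw [← SetLike.mem_coe, ← (isClosed_weightClosure n).closure_eq, mem_closure_iff_forall_sub_mem]
  intro k
  obtain ⟨s, hs⟩ := exists_sub_sum_dirac_mem μ (max n k)
  refine ⟨_, sum_smul_dirac_mem_weightClosure ?_,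
    nbhdIdeal_anti (le_max_right n k) (le_max_right n k) hs⟩
  simpa only [sub_sub_cancel] using
    sub_mem hμ (nbhdIdeal_anti (le_max_left n k) (le_max_left n k) hs)

end DiracExpansion

section Series

theorem min_le_weight_add (a b : ℤ_[p]) (q : S p) :
    min (weight a q) (weight b q) ≤ weight (a + b) q :=
  WithTop.forall_coe_le_iff_le.1 fun _ hC => le_weight_iff.2 <|
    dvd_add (le_weight_iff.1 (le_min_iff.1 hC).1) (le_weight_iff.1 (le_min_iff.1 hC).2)

theorem weight_neg (a : ℤ_[p]) (q : S p) : weight (-a) q = weight a q :=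
  WithTop.eq_of_forall_coe_le_iff fun C => by rw [le_weight_iff, le_weight_iff, dvd_neg]

theorem le_weight_of_hasSum {ι : Type*} {C : ℝ} {f : ι → ℤ_[p]} {a : ℤ_[p]} {q : S p}
    (hf : ∀ i, (C : WithTop ℝ) ≤ weight (f i) q) (h : HasSum f a) :
    (C : WithTop ℝ) ≤ weight a q :=
  le_weight_iff.2 (pow_dvd_of_hasSum (fun i => le_weight_iff.1 (hf i)) h)

theorem WeightsTendToTop.add {a b : S p → ℤ_[p]} (ha : WeightsTendToTop a)
    (hb : WeightsTendToTop b) : WeightsTendToTop (a + b) := fun C hC => by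
  filter_upwards [ha C hC, hb C hC] with q haq hbq
  exact (lt_min haq hbq).trans_le (min_le_weight_add _ _ _)

theorem WeightsTendToTop.neg {a : S p → ℤ_[p]} (ha : WeightsTendToTop a) :
    WeightsTendToTop (-a) := fun C hC => by
  filter_upwards [ha C hC] with q haq
  rwa [Pi.neg_apply, weight_neg]

theorem WeightsTendToTop.mono {a b : S p → ℤ_[p]} (ha : WeightsTendToTop a)
    (h : ∀ q, weight (a q) q ≤ weight (b q) q) : WeightsTendToTop b := fun C hC =>
  (ha C hC).mono fun q hq => hq.trans_le (h q)

theorem weightsTendToTop_finsupp (f : S p →₀ ℤ_[p]) : WeightsTendToTop f := fun C _ => by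
  filter_upwards [f.support.finite_toSet.compl_mem_cofinite] with q hq
  rw [Finsupp.notMem_support_iff.1 hq, weight_zero]
  exact WithTop.coe_lt_top C

theorem hasSum_finsupp (f : S p →₀ ℤ_[p]) :
    HasSum (fun q => f q • tPow q) (f.sum fun q a => a • tPow q) :=
  hasSum_sum_of_ne_finset_zero fun q hq => by
    rw [Finsupp.notMem_support_iff.1 hq, zero_smul]

theorem summable_smul_tPow {ι : Type*} {a : ι → ℤ_[p]} {q : ι → S p}
    (h : ∀ C : ℝ, 0 < C → ∀ᶠ i in cofinite, (C : WithTop ℝ) < weight (a i) (q i)) :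
    Summable fun i => a i • tPow (q i) := by
  refine NonarchimedeanAddGroup.summable_of_tendsto_cofinite_zero
    (hasBasis_nhds_zero.tendsto_right_iff.2 fun n _ => ?_)
  filter_upwards [h (n * p ^ n + n + 1) (by positivity)] with i hi
  exact smul_tPow_mem_nbhdIdeal (le_trans (WithTop.coe_le_coe.2 (by linarith)) hi.le)

theorem WeightsTendToTop.summable {a : S p → ℤ_[p]} (ha : WeightsTendToTop a) :
    Summable fun q => a q • tPow q := summable_smul_tPow ha

theorem summable_of_weight {ι : Type*} {a : ι → ℤ_[p]} {q : S p}
    (h : ∀ C : ℝ, 0 < C → ∀ᶠ i in cofinite, (C : WithTop ℝ) < weight (a i) q) : Summable a := by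
  refine NonarchimedeanAddGroup.summable_of_tendsto_cofinite_zero
    (padicInt_hasBasis_nhds_zero.tendsto_right_iff.2 fun k _ => ?_)
  have hq := S_nonneg q
  filter_upwards [h (k + q + 1) (by positivity)] with i hi
  refine (pow_dvd_pow _ ?_).trans (le_weight_iff.1 hi.le)
  have hceil : (k : ℝ) ≤ ⌈(k + q + 1 : ℝ) - q⌉₊ := le_trans (by linarith) (Nat.le_ceil _)
  exact_mod_cast hceil

section Columns

variable {ι : Type*} {c : ι → S p → ℤ_[p]}
  (hc : ∀ C : ℝ, 0 < C → ∀ᶠ x : ι × S p in cofinite, (C : WithTop ℝ) < weight (c x.1 x.2) x.2)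

include hc

theorem summable_column (q : S p) : Summable fun i => c i q :=
  summable_of_weight fun C hC =>
    (Prod.mk_left_injective q).tendsto_cofinite.eventually (hc C hC)

theorem weightsTendToTop_tsum : WeightsTendToTop fun q => ∑' i, c i q := fun C hC => by
  have hfin := (eventually_cofinite.1 (hc (C + 1) (by positivity))).image Prod.snd
  filter_upwards [hfin.compl_mem_cofinite] with q hq
  have hle : ∀ i, ((C + 1 : ℝ) : WithTop ℝ) ≤ weight (c i q) q := fun i => by
    by_contra hlt
    exact hq ⟨(i, q), fun h => hlt h.le, rfl⟩
  exact (WithTop.coe_lt_coe.2 (lt_add_one C)).trans_le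
    (le_weight_of_hasSum hle (summable_column hc q).hasSum)

theorem hasSum_tsum_smul_tPow {μ : UnifMeasure p}
    (hμ : HasSum (fun x : ι × S p => c x.1 x.2 • tPow x.2) μ) :
    HasSum (fun q => (∑' i, c i q) • tPow q) μ :=
  ((Equiv.prodComm (S p) ι).hasSum_iff.2 hμ).prod_fiberwise fun q =>
    (summable_column hc q).hasSum.smul_const (tPow q)

end Columns

theorem exists_hasSum_finiteSums {n : ℕ} {μ : UnifMeasure p} (hμ : μ ∈ nbhdIdeal p n n) :
    ∃ y : ℕ → UnifMeasure p, (∀ i : ℕ, y i ∈ finiteSums p ((n + i : ℕ) : ℝ)) ∧ HasSum y μ := by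
  let U : ℕ → AddSubgroup (UnifMeasure p) := fun i => (nbhdIdeal p (n + i) (n + i)).toAddSubgroup
  have hU : Antitone U := fun i j hij => nbhdIdeal_anti (by omega) (by omega)
  have hbasis : (𝓝 (0 : UnifMeasure p)).HasBasis (fun _ : ℕ => True) fun i => (U i : Set _) :=
    hasBasis_nhds_zero.to_hasBasis
      (fun i _ => ⟨i, trivial, nbhdIdeal_anti (Nat.le_add_left i n) (Nat.le_add_left i n)⟩)
      fun i _ => ⟨n + i, trivial, le_rfl⟩
  have happrox : ∀ i, ∀ x ∈ U i,
      ∃ y ∈ (finiteSums p ((n + i : ℕ) : ℝ) ∩ U i : Set (UnifMeasure p)), x - y ∈ U (i + 1) :=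
      fun i x hx => by
    obtain ⟨y, hy, hxy⟩ :=
      mem_weightClosure_iff.1 (mem_weightClosure_of_mem_nbhdIdeal hx) (n + (i + 1))
    have hyU : y ∈ U i := sub_sub_cancel x y ▸ sub_mem hx (hU (Nat.le_succ i) hxy)
    exact ⟨y, ⟨hy, hyU⟩, hxy⟩
  obtain ⟨y, hy, hsum⟩ := exists_hasSum_of_approx hU hbasis
    (fun i => inter_subset_right) happrox (x := μ) hμ
  exact ⟨y, fun i => (hy i).1, hsum⟩

theorem eventually_lt_weight_finsupp {b : ℕ → S p →₀ ℤ_[p]}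
    (hb : ∀ (i : ℕ) q, ((i : ℝ) : WithTop ℝ) ≤ weight (b i q) q) (C : ℝ) :
    ∀ᶠ x : ℕ × S p in cofinite, (C : WithTop ℝ) < weight (b x.1 x.2) x.2 := by
  have hfin : (⋃ i ∈ Finset.range (⌊C⌋₊ + 1), {i} ×ˢ ((b i).support : Set (S p))).Finite :=
    (Finset.finite_toSet _).biUnion fun i _ => (finite_singleton i).prod (Finset.finite_toSet _)
  filter_upwards [hfin.compl_mem_cofinite] with ⟨i, q⟩ hx
  by_cases hi : i < ⌊C⌋₊ + 1
  · have hzero : b i q = 0 := by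
      by_contra hne
      exact hx (mem_biUnion (Finset.mem_range.2 hi) ⟨rfl, Finsupp.mem_support_iff.2 hne⟩)
    rw [hzero, weight_zero]
    exact WithTop.coe_lt_top C
  · refine lt_of_lt_of_le (WithTop.coe_lt_coe.2 ?_) (hb i q)
    exact (Nat.lt_floor_add_one C).trans_le (by exact_mod_cast not_lt.1 hi)

theorem exists_series_of_mem_nbhdIdeal {n : ℕ} {μ : UnifMeasure p} (hμ : μ ∈ nbhdIdeal p n n) :
    ∃ a : S p → ℤ_[p], WeightsTendToTop a ∧ HasSum (fun q => a q • tPow q) μ ∧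
      ∀ q, ((n : ℝ) : WithTop ℝ) ≤ weight (a q) q := by
  obtain ⟨y, hy, hsum⟩ := exists_hasSum_finiteSums hμ
  choose b hb hby using fun i => exists_finsupp_of_mem_finiteSums (hy i)
  have hle : ∀ {k i : ℕ} (q : S p), k ≤ n + i → ((k : ℝ) : WithTop ℝ) ≤ weight (b i q) q :=
    fun q hk => (WithTop.coe_le_coe.2 (Nat.cast_le.2 hk)).trans (hb _ q)
  have hc : ∀ C : ℝ, 0 < C → ∀ᶠ x : ℕ × S p in cofinite,
      (C : WithTop ℝ) < weight (b x.1 x.2) x.2 := fun C _ =>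
    eventually_lt_weight_finsupp (fun i q => hle q (Nat.le_add_left i n)) C
  have hdouble : HasSum (fun x : ℕ × S p => b x.1 x.2 • tPow x.2) μ := by
    have hsum' := (summable_smul_tPow hc).hasSum
    rwa [(hsum'.prod_fiberwise fun i => hby i ▸ hasSum_finsupp (b i)).unique hsum] at hsum'
  exact ⟨fun q => ∑' i, b i q, weightsTendToTop_tsum hc, hasSum_tsum_smul_tPow hc hdouble,
    fun q => le_weight_of_hasSum (fun i => hle q (Nat.le_add_right n i))
      (summable_column hc q).hasSum⟩

theorem exists_series_of_mem_weightClosure {C : ℝ} {μ : UnifMeasure p}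
    (hμ : μ ∈ weightClosure p C) :
    ∃ a : S p → ℤ_[p], WeightsTendToTop a ∧ HasSum (fun q => a q • tPow q) μ ∧
      ∀ q, (C : WithTop ℝ) ≤ weight (a q) q := by
  obtain ⟨y, hy, hμy⟩ := mem_weightClosure_iff.1 hμ ⌈C⌉₊
  obtain ⟨f, hf, rfl⟩ := exists_finsupp_of_mem_finiteSums hy
  obtain ⟨a, ha, hsum, haC⟩ := exists_series_of_mem_nbhdIdeal hμy
  refine ⟨f + a, (weightsTendToTop_finsupp f).add ha, ?_, fun q => (le_min (hf q)
    ((WithTop.coe_le_coe.2 (Nat.le_ceil C)).trans (haC q))).trans (min_le_weight_add _ _ _)⟩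
  simpa only [Pi.add_apply, add_smul, add_sub_cancel] using (hasSum_finsupp f).add hsum

theorem exists_series (μ : UnifMeasure p) :
    ∃ a : S p → ℤ_[p], WeightsTendToTop a ∧ HasSum (fun q => a q • tPow q) μ := by
  obtain ⟨a, ha, hsum, -⟩ := exists_series_of_mem_nbhdIdeal (n := 0) (μ := μ)
    (nbhdIdeal_zero (p := p) 0 ▸ Submodule.mem_top)
  exact ⟨a, ha, hsum⟩

theorem mem_weightClosure_of_hasSum {C : ℝ} {μ : UnifMeasure p} {a : S p → ℤ_[p]}
    (ha : ∀ q, (C : WithTop ℝ) ≤ weight (a q) q) (h : HasSum (fun q => a q • tPow q) μ) :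
    μ ∈ weightClosure p C :=
  hasSum_mem_of_isClosed (isClosed_weightClosure C)
    (fun q => finiteSums_le_weightClosure _ (smul_tPow_mem_finiteSums (ha q))) h

end Series

section Uniqueness

open Polynomial

theorem proj_mul_inv_pow_injOn (n h : ℕ) :
    InjOn (fun k : ℕ => proj p h (k * (1 / (p : ℚ_[p]) ^ n))) (Iio (p ^ (n + h))) := by
  intro k hk k' hk' H
  have hp : (0 : ℝ) < p := Nat.cast_pos.2 (NeZero.pos p)
  rw [proj_eq_iff, ← sub_mul, norm_mul, norm_div, norm_one, norm_pow, Padic.norm_p, inv_pow,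
    one_div, inv_inv, ← le_div_iff₀ (by positivity)] at H
  have hnorm : ‖((k - k' : ℤ) : ℚ_[p])‖ ≤ (p : ℝ) ^ (-((n + h : ℕ) : ℤ)) := by
    push_cast
    refine H.trans_eq ?_
    rw [neg_add, zpow_add₀ hp.ne', zpow_neg, zpow_neg, zpow_natCast, zpow_natCast, div_eq_mul_inv,
      mul_comm]
  rw [Padic.norm_int_le_pow_iff_dvd] at hnorm
  have hmod : k' ≡ k [MOD p ^ (n + h)] := Nat.modEq_iff_dvd.2 (by exact_mod_cast hnorm)
  exact hmod.symm.eq_of_lt_of_lt hk hk'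

theorem C_p_dvd_of_aeval_dirac_mem {n h : ℕ} {Q : ℤ_[p][X]} (hQ : Q.degree < (p ^ (n + h) : ℕ))
    (H : aeval (dirac (1 / (p : ℚ_[p]) ^ n)) Q ∈ nbhdIdeal p h 1) : C (p : ℤ_[p]) ∣ Q := by
  classical
  rcases eq_or_ne Q 0 with rfl | hne
  · exact dvd_zero _
  refine (C_dvd_iff_dvd_coeff _ _).2 fun k => ?_
  by_cases hk : k < p ^ (n + h)
  · have hball := H (proj p h (k * (1 / (p : ℚ_[p]) ^ n)))
    rw [aeval_eq_sum_range' ((natDegree_lt_iff_degree_lt hne).2 hQ), ball_sum_smul,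
      Finset.sum_eq_single_of_mem k (Finset.mem_range.2 hk)] at hball
    · rwa [dirac_pow, dirac_ball, if_pos rfl, pow_one, mul_one] at hball
    · intro j hj hjk
      rw [dirac_pow, dirac_ball, if_neg, mul_zero]
      exact fun heq => hjk (proj_mul_inv_pow_injOn n h (Finset.mem_range.1 hj) hk heq)
  · rw [coeff_eq_zero_of_degree_lt (hQ.trans_le (Nat.cast_le.2 (not_lt.1 hk)))]
    exact dvd_zero _

theorem C_p_dvd_of_aeval_T_mem {n h : ℕ} {P : ℤ_[p][X]} (hP : P.degree < (p ^ (n + h) : ℕ))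
    (H : aeval (T p n) P ∈ nbhdIdeal p h 1) : C (p : ℤ_[p]) ∣ P := by
  have hdvd : C (p : ℤ_[p]) ∣ taylor (-1) P := by
    refine C_p_dvd_of_aeval_dirac_mem (n := n) (h := h) (by rwa [degree_taylor]) ?_
    rw [taylor_apply, aeval_comp, dirac_eq_one_add_T]
    simpa using H
  simpa [taylor_taylor] using map_dvd (taylorAlgHom (1 : ℤ_[p])) hdvd

theorem C_p_dvd_of_aeval_tT_mem {n h : ℕ} {P : ℤ_[p][X]} (hP : P.degree < (p ^ (n + h) : ℕ))
    (H : aeval (tT p n) P ∈ nbhdIdeal p h 1) : C (p : ℤ_[p]) ∣ P := by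
  have hdvd : (p : UnifMeasure p) ^ 1 ∣ aeval (tT p n) P - aeval (T p n) P := by
    rw [pow_one, ← eval_map_algebraMap, ← eval_map_algebraMap]
    exact (p_dvd_tT_sub_T n).trans (sub_dvd_eval_sub _ _ _)
  exact C_p_dvd_of_aeval_T_mem hP <| by
    simpa only [sub_sub_cancel] using sub_mem H (p_pow_dvd_iff.1 hdvd h)

theorem sum_mem_of_hasSum_mem {ι G σ : Type*} [AddCommGroup G] [TopologicalSpace G]
    [IsTopologicalAddGroup G] [SetLike σ G] [AddSubgroupClass σ G] {H : σ}
    (hH : IsClosed (H : Set G)) {f : ι → G} {x : G} (hf : HasSum f x) (hx : x ∈ H) (s : Finset ι)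
    (hs : ∀ i ∉ s, f i ∈ H) : ∑ i ∈ s, f i ∈ H := by
  have hcompl : x - ∑ i ∈ s, f i ∈ H :=
    hasSum_mem_of_isClosed hH (fun i : {i // i ∉ s} => hs i.1 i.2)
      ((Finset.hasSum_compl_iff s).2 (by simpa using hf))
  simpa using sub_mem hx hcompl

theorem sFrac_lt_pow_iff {n h i : ℕ} : (sFrac p n i : ℝ) < (p : ℝ) ^ h ↔ i < p ^ (n + h) := by
  have hp : (0 : ℝ) < p := Nat.cast_pos.2 (NeZero.pos p)
  rw [coe_sFrac, div_lt_iff₀ (by positivity), ← pow_add, add_comm]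
  exact_mod_cast Iff.rfl

theorem eventually_forall_smul_tPow_mem_nbhdIdeal {a : S p → ℤ_[p]} (ha : WeightsTendToTop a)
    (h : ℕ) : ∀ᶠ n in atTop, ∀ q, (∀ i < p ^ (n + h), sFrac p n i ≠ q) →
      a q • tPow q ∈ nbhdIdeal p h 1 := by
  have hfin : {q | a q • tPow q ∉ nbhdIdeal p h 1}.Finite :=
    (eventually_cofinite.1 (ha ((1 : ℕ) * (p : ℝ) ^ h + (1 : ℕ)) (by positivity))).subset
      fun q hq hlt => hq (smul_tPow_mem_nbhdIdeal hlt.le)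
  filter_upwards [hfin.eventually_all.2 fun q _ => eventually_exists_eq_sFrac q] with n hn q hq
  by_contra hmem
  obtain ⟨i, rfl⟩ := hn q hmem
  refine hq i (sFrac_lt_pow_iff.1 (not_le.1 fun hle => hmem ?_)) rfl
  exact Submodule.smul_of_tower_mem _ _ (tPow_mem_nbhdIdeal (by simpa using hle))

theorem p_dvd_of_hasSum {a : S p → ℤ_[p]} {μ : UnifMeasure p} (ha : WeightsTendToTop a)
    (hsum : HasSum (fun q => a q • tPow q) μ) (hμ : (p : UnifMeasure p) ∣ μ) (q : S p) :
    (p : ℤ_[p]) ∣ a q := by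
  classical
  obtain ⟨h, hqh⟩ := pow_unbounded_of_one_lt (q : ℝ)
    (show (1 : ℝ) < p by exact_mod_cast (Fact.out : p.Prime).one_lt)
  obtain ⟨n, hn, i, rfl⟩ := ((eventually_forall_smul_tPow_mem_nbhdIdeal ha h).and
    (eventually_exists_eq_sFrac q)).exists
  have hi : i < p ^ (n + h) := sFrac_lt_pow_iff.1 hqh
  let P : ℤ_[p][X] := PowerSeries.trunc (p ^ (n + h)) (PowerSeries.mk fun i => a (sFrac p n i))
  have hP : C (p : ℤ_[p]) ∣ P := by
    refine C_p_dvd_of_aeval_tT_mem (PowerSeries.degree_trunc_lt _ _) (n := n) (h := h) ?_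
    have htrunc := sum_mem_of_hasSum_mem (isClosed_nbhdIdeal h 1) hsum
      (p_pow_dvd_iff.1 ((pow_one (p : UnifMeasure p)).symm ▸ hμ) h)
      ((Finset.range (p ^ (n + h))).image (sFrac p n)) fun q hq => hn q fun i hi hiq =>
        hq (Finset.mem_image.2 ⟨i, Finset.mem_range.2 hi, hiq⟩)
    rw [Finset.sum_image (sFrac_injective n).injOn] at htrunc
    rw [aeval_def, PowerSeries.eval₂_trunc_eq_sum_range]
    simpa only [PowerSeries.coeff_mk, ← Algebra.smul_def, ← tPow_sFrac] using htrunc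
  have hdvd := (C_dvd_iff_dvd_coeff _ _).1 hP i
  rwa [PowerSeries.coeff_trunc, if_pos hi, PowerSeries.coeff_mk] at hdvd

theorem weight_p_pow_mul (n : ℕ) (a : ℤ_[p]) (q : S p) :
    weight ((p : ℤ_[p]) ^ n * a) q = ((n : ℝ) : WithTop ℝ) + weight a q := by
  rw [← zero_add q, weight_mul, weight_of_ne_zero (pow_ne_zero _ (NeZero.ne _)),
    PadicInt.valuation_pow, PadicInt.valuation_p, zero_add]
  simp

theorem p_pow_dvd_of_hasSum {k : ℕ} {a : S p → ℤ_[p]} {μ : UnifMeasure p}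
    (ha : WeightsTendToTop a) (hsum : HasSum (fun q => a q • tPow q) μ)
    (hμ : (p : UnifMeasure p) ^ k ∣ μ) (q : S p) : (p : ℤ_[p]) ^ k ∣ a q := by
  induction k generalizing a μ with
  | zero => simp
  | succ k ih =>
    choose b hb using p_dvd_of_hasSum ha hsum ((dvd_pow_self _ k.succ_ne_zero).trans hμ)
    have hbw : WeightsTendToTop b := fun C hC => by
      filter_upwards [ha (1 + C) (by linarith)] with q hq
      rw [hb, ← pow_one (p : ℤ_[p]), weight_p_pow_mul, Nat.cast_one, WithTop.coe_add] at hq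
      exact lt_of_add_lt_add_left hq
    have hmul : (p : UnifMeasure p) * ∑' q, b q • tPow q = μ := by
      refine (hbw.summable.hasSum.mul_left (p : UnifMeasure p)).unique ?_
      simpa only [hb, mul_smul, Nat.cast_smul_eq_nsmul, nsmul_eq_mul] using hsum
    obtain ⟨ν, hν⟩ := hμ
    have hsub : (p : UnifMeasure p) * ((∑' q, b q • tPow q) - p ^ k * ν) = 0 := by
      rw [mul_sub, hmul, hν, pow_succ']
      ring
    have hdvd := ih hbw hbw.summable.hasSum ⟨ν, sub_eq_zero.1 (eq_zero_of_p_mul_eq_zero hsub)⟩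
    rw [hb, pow_succ']
    exact mul_dvd_mul_left _ hdvd

theorem series_unique {a b : S p → ℤ_[p]} {μ : UnifMeasure p} (ha : WeightsTendToTop a)
    (hb : WeightsTendToTop b) (hasum : HasSum (fun q => a q • tPow q) μ)
    (hbsum : HasSum (fun q => b q • tPow q) μ) : a = b := by
  have hsub : HasSum (fun q => (a + -b) q • tPow q) 0 := by
    simpa [← sub_eq_add_neg, sub_smul] using hasum.sub hbsum
  refine funext fun q => sub_eq_zero.1 (eq_zero_of_forall_pow_dvd fun k => ?_)
  simpa [← sub_eq_add_neg] using p_pow_dvd_of_hasSum (ha.add hb.neg) hsub (dvd_zero _) q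

theorem existsUnique_series (μ : UnifMeasure p) :
    ∃! a : S p → ℤ_[p], WeightsTendToTop a ∧ HasSum (fun q => a q • tPow q) μ :=
  existsUnique_of_exists_of_unique (exists_series μ)
    fun _ _ ha hb => series_unique ha.1 hb.1 ha.2 hb.2

end Uniqueness

section Valuation

theorem exists_isLeast_weight {a : S p → ℤ_[p]} (ha : WeightsTendToTop a) :
    ∃ m, IsLeast (range fun q : S p => weight (a q) q) m := by
  rcases eq_or_ne a 0 with rfl | hne
  · exact ⟨⊤, ⟨0, weight_zero 0⟩, by rintro _ ⟨q, rfl⟩; exact (weight_zero q).ge⟩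
  obtain ⟨r, hr⟩ := Function.ne_iff.1 hne
  have hr₀ := S_nonneg r
  let C : ℝ := (a r).valuation + r + 1
  have hrC : weight (a r) r < C := by
    rw [weight_of_ne_zero hr]
    exact WithTop.coe_lt_coe.2 (lt_add_one _)
  obtain ⟨m, -, hmin⟩ := exists_min_image _ (fun q => weight (a q) q)
    (eventually_cofinite.1 (ha C (by positivity))) ⟨r, hrC.not_gt⟩
  refine ⟨_, ⟨m, rfl⟩, ?_⟩
  rintro _ ⟨q, rfl⟩
  by_cases hq : (C : WithTop ℝ) < weight (a q) q
  · exact (hmin r hrC.not_gt).trans (hrC.trans hq).le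
  · exact hmin q hq

/-- The valuation `w` on uniform measures as a function: the least weight `v(a_q) + q` of the terms
of an `S`-series with sum `μ`. The series is unique by `series_unique`, so that its choice does not
matter. -/
def wFun (μ : UnifMeasure p) : WithTop ℝ :=
  (exists_isLeast_weight (exists_series μ).choose_spec.1).choose

theorem isLeast_wFun {μ : UnifMeasure p} {a : S p → ℤ_[p]} (ha : WeightsTendToTop a)
    (hsum : HasSum (fun q => a q • tPow q) μ) :
    IsLeast (range fun q : S p => weight (a q) q) (wFun μ) := by
  have hchoice := (exists_series μ).choose_spec
  rw [series_unique ha hchoice.1 hsum hchoice.2]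
  exact (exists_isLeast_weight hchoice.1).choose_spec

theorem le_wFun_iff {C : ℝ} {μ : UnifMeasure p} :
    (C : WithTop ℝ) ≤ wFun μ ↔ μ ∈ weightClosure p C := by
  constructor
  · obtain ⟨a, ha, hsum⟩ := exists_series μ
    exact fun hC => mem_weightClosure_of_hasSum
      (fun q => hC.trans ((isLeast_wFun ha hsum).2 ⟨q, rfl⟩)) hsum
  · intro hμ
    obtain ⟨a, ha, hsum, hC⟩ := exists_series_of_mem_weightClosure hμ
    obtain ⟨q, hq⟩ := (isLeast_wFun ha hsum).1
    exact hq ▸ hC q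

theorem wFun_smul_tPow (a : ℤ_[p]) (q : S p) : wFun (a • tPow q) = weight a q := by
  classical
  have hsum : HasSum (fun r => Finsupp.single q a r • tPow r) (a • tPow q) := by
    simpa only [Finsupp.sum_single_index, zero_smul] using hasSum_finsupp (Finsupp.single q a)
  refine (isLeast_wFun (weightsTendToTop_finsupp _) hsum).unique
    ⟨⟨q, by simp only [Finsupp.single_eq_same]⟩, ?_⟩
  rintro _ ⟨r, rfl⟩
  rcases eq_or_ne q r with rfl | hqr
  · simp only [Finsupp.single_eq_same, le_refl]
  · simp only [Finsupp.single_eq_of_ne' hqr, weight_zero, le_top]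

theorem wFun_zero : wFun (0 : UnifMeasure p) = ⊤ := by
  simpa using wFun_smul_tPow (p := p) 0 0

theorem wFun_tPow (q : S p) : wFun (tPow q) = ((q : ℝ) : WithTop ℝ) := by
  simpa [weight_of_ne_zero] using wFun_smul_tPow 1 q

theorem wFun_one : wFun (1 : UnifMeasure p) = 0 := by
  simpa [tPow_zero] using wFun_tPow (p := p) 0

theorem wFun_p : wFun (p : UnifMeasure p) = ((1 : ℝ) : WithTop ℝ) := by
  have hp : (p : ℤ_[p]) ≠ 0 := NeZero.ne _
  simpa [tPow_zero, weight_of_ne_zero hp, Nat.cast_smul_eq_nsmul] using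
    wFun_smul_tPow (p := p) (p : ℤ_[p]) 0

theorem eq_zero_of_wFun_eq_top {μ : UnifMeasure p} (h : wFun μ = ⊤) : μ = 0 := by
  obtain ⟨a, ha, hsum⟩ := exists_series μ
  have hzero : ∀ q, a q = 0 := fun q => by
    by_contra hne
    have hq := top_le_iff.1 (h ▸ (isLeast_wFun ha hsum).2 ⟨q, rfl⟩)
    exact WithTop.coe_ne_top ((weight_of_ne_zero hne q).symm.trans hq)
  simp only [hzero, zero_smul] at hsum
  exact hsum.unique hasSum_zero

theorem min_wFun_le_add (x y : UnifMeasure p) : min (wFun x) (wFun y) ≤ wFun (x + y) :=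
  WithTop.forall_coe_le_iff_le.1 fun C hC => by
    rw [le_min_iff, le_wFun_iff, le_wFun_iff] at hC
    exact le_wFun_iff.2 (add_mem hC.1 hC.2)

theorem wFun_neg (x : UnifMeasure p) : wFun (-x) = wFun x :=
  WithTop.eq_of_forall_coe_le_iff fun C => by rw [le_wFun_iff, le_wFun_iff, neg_mem_iff]

theorem wFun_add_le_mul (x y : UnifMeasure p) : wFun x + wFun y ≤ wFun (x * y) := by
  cases hx : wFun x with
  | top => rw [eq_zero_of_wFun_eq_top hx, zero_mul, wFun_zero, top_add]
  | coe C =>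
    cases hy : wFun y with
    | top => rw [eq_zero_of_wFun_eq_top hy, mul_zero, wFun_zero, add_top]
    | coe C' =>
      exact le_wFun_iff.2 (mul_mem_weightClosure (le_wFun_iff.1 hx.ge) (le_wFun_iff.1 hy.ge))

theorem WeightsTendToTop.indicator {a : S p → ℤ_[p]} (ha : WeightsTendToTop a) (s : Set (S p)) :
    WeightsTendToTop (s.indicator a) := ha.mono fun q => by
  by_cases hq : q ∈ s <;> simp [hq]

theorem exists_leading_part {x : UnifMeasure p} {C : ℝ} (hx : wFun x = C) :
    ∃ f : S p →₀ ℤ_[p], f.support.Nonempty ∧ (∀ q ∈ f.support, weight (f q) q = C) ∧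
      (C : WithTop ℝ) < wFun (x - f.sum fun q a => a • tPow q) := by
  obtain ⟨a, ha, hsum⟩ := exists_series x
  have hleast := hx ▸ isLeast_wFun ha hsum
  let s : Set (S p) := {q | weight (a q) q = C}
  have hfin : s.Finite := (eventually_cofinite.1 (ha (max C 1) (by positivity))).subset
    fun q (hq : _ = _) => by simp [hq]
  let f := Finsupp.ofSupportFinite (s.indicator a) (hfin.subset support_indicator_subset)
  have hrest : HasSum (fun q => sᶜ.indicator a q • tPow q) (x - f.sum fun q a => a • tPow q) := by
    rw [indicator_compl, show s.indicator a = f from Finsupp.ofSupportFinite_coe.symm]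
    simpa only [Pi.sub_apply, sub_smul] using hsum.sub (hasSum_finsupp f)
  refine ⟨f, ?_, fun q hq => ?_, ?_⟩
  · obtain ⟨q, hq⟩ := hleast.1
    refine ⟨q, Finsupp.mem_support_iff.2 fun hzero => WithTop.top_ne_coe (a := C) ?_⟩
    rw [← weight_zero q, ← hzero, ← hq]
    exact congrArg (weight · q) (indicator_of_mem (s := s) hq a)
  · have hqs : q ∈ s := mem_of_indicator_ne_zero (Finsupp.mem_support_iff.1 hq)
    exact (congrArg (weight · q) (indicator_of_mem hqs a)).trans hqs
  · obtain ⟨q, hq⟩ := (isLeast_wFun (ha.indicator sᶜ) hrest).1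
    rw [← hq]
    by_cases hqs : q ∈ s
    · simp [hqs]
    · simpa [hqs] using lt_of_le_of_ne (hleast.2 ⟨q, rfl⟩) (Ne.symm hqs)

/-- `q ↦ T̃ ^ q` as a homomorphism of monoids. -/
def tPowHom (p : ℕ) [Fact p.Prime] : Multiplicative (S p) →* UnifMeasure p where
  toFun q := tPow q.toAdd
  map_one' := tPow_zero
  map_mul' _ _ := tPow_add _ _

theorem wFun_mul_le_of_homogeneous {f g : S p →₀ ℤ_[p]} {C C' : ℝ} (hf : f.support.Nonempty)
    (hg : g.support.Nonempty) (hfC : ∀ q ∈ f.support, weight (f q) q = C)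
    (hgC : ∀ q ∈ g.support, weight (g q) q = C') :
    wFun ((f.sum fun q a => a • tPow q) * g.sum fun q a => a • tPow q) ≤
      ((C + C' : ℝ) : WithTop ℝ) := by
  -- Exponents `q` and `r` whose sum arises only once: the coefficient there is `f q * g r`.
  obtain ⟨q, hq, r, hr, hunique⟩ := UniqueSums.uniqueAdd_of_nonempty hf hg
  let F : AddMonoidAlgebra ℤ_[p] (S p) := .ofCoeff f
  let G : AddMonoidAlgebra ℤ_[p] (S p) := .ofCoeff g
  have hlift : ∀ H : AddMonoidAlgebra ℤ_[p] (S p),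
      AddMonoidAlgebra.lift ℤ_[p] _ _ (tPowHom p) H = H.coeff.sum fun q a => a • tPow q :=
    fun H => AddMonoidAlgebra.lift_apply _ _
  have hFG : (f.sum fun q a => a • tPow q) * (g.sum fun q a => a • tPow q) =
      (F * G).coeff.sum fun q a => a • tPow q := by
    rw [← hlift (F * G), map_mul, hlift, hlift]
  have hcoeff : (F * G).coeff (q + r) = f q * g r :=
    AddMonoidAlgebra.coeff_mul_add_of_uniqueAdd (f := F) (g := G) hunique
  calc wFun ((f.sum fun q a => a • tPow q) * g.sum fun q a => a • tPow q)
      ≤ weight ((F * G).coeff (q + r)) (q + r) :=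
        hFG ▸ (isLeast_wFun (weightsTendToTop_finsupp _) (hasSum_finsupp _)).2 ⟨q + r, rfl⟩
    _ = ((C + C' : ℝ) : WithTop ℝ) := by
        rw [hcoeff, weight_mul, hfC q hq, hgC r hr, WithTop.coe_add]

theorem le_wFun_finsupp {f : S p →₀ ℤ_[p]} {C : ℝ} (hf : ∀ q ∈ f.support, weight (f q) q = C) :
    (C : WithTop ℝ) ≤ wFun (f.sum fun q a => a • tPow q) :=
  le_wFun_iff.2 <| sum_mem fun q hq =>
    finiteSums_le_weightClosure _ (smul_tPow_mem_finiteSums (hf q hq).ge)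

theorem wFun_mul (x y : UnifMeasure p) : wFun (x * y) = wFun x + wFun y := by
  refine le_antisymm ?_ (wFun_add_le_mul x y)
  cases hx : wFun x with
  | top => exact le_top
  | coe C =>
  cases hy : wFun y with
  | top => exact le_top
  | coe C' =>
  obtain ⟨f, hf, hfC, hfx⟩ := exists_leading_part hx
  obtain ⟨g, hg, hgC, hgy⟩ := exists_leading_part hy
  have hlead := wFun_mul_le_of_homogeneous hf hg hfC hgC
  have hfw := le_wFun_finsupp hfC
  set x₀ := f.sum fun q a => a • tPow q
  set y₀ := g.sum fun q a => a • tPow q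
  rw [← WithTop.coe_add]
  by_contra! hlt
  have hright : ((C + C' : ℝ) : WithTop ℝ) < wFun (x₀ * (y - y₀)) :=
    (WithTop.add_lt_add_of_le_of_lt WithTop.coe_ne_top hfw hgy).trans_le (wFun_add_le_mul _ _)
  have hleft : ((C + C' : ℝ) : WithTop ℝ) < wFun ((x - x₀) * y) :=
    (WithTop.add_lt_add_of_lt_of_le WithTop.coe_ne_top hfx hy.ge).trans_le (wFun_add_le_mul _ _)
  have hrest := (lt_min hright hleft).trans_le (min_wFun_le_add _ _)
  rw [← wFun_neg] at hrest
  have hsplit : x * y + -(x₀ * (y - y₀) + (x - x₀) * y) = x₀ * y₀ := by ring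
  exact ((lt_min hlt hrest).trans_le (min_wFun_le_add _ _)).not_ge (hsplit ▸ hlead)

/-- The valuation `w` on the ring of uniform measures. -/
def wVal (p : ℕ) [Fact p.Prime] : AddValuation (UnifMeasure p) (WithTop ℝ) :=
  AddValuation.of wFun wFun_zero wFun_one min_wFun_le_add wFun_mul

end Valuation

section Topologies

theorem hasBasis_nhds_zero_wVal : (𝓝 (0 : UnifMeasure p)).HasBasis (fun _ : ℕ => True)
    fun n => {x | ((n : ℝ) : WithTop ℝ) ≤ wVal p x} := by
  refine hasBasis_nhds_zero.to_hasBasis (fun n _ => ⟨n * p ^ n + n, trivial, fun x hx => ?_⟩)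
    fun n _ => ⟨n, trivial, fun x hx => le_wFun_iff.2 (mem_weightClosure_of_mem_nbhdIdeal hx)⟩
  obtain ⟨a, ha, hsum⟩ := exists_series x
  refine hasSum_mem_of_isClosed (isClosed_nbhdIdeal n n)
    (fun q => smul_tPow_mem_nbhdIdeal ?_) hsum
  exact_mod_cast hx.trans ((isLeast_wFun ha hsum).2 ⟨q, rfl⟩)

section ValUniformSpace

variable {A : Type} [CommRing A] (w : AddValuation A (WithTop ℝ))

theorem isUniformAddGroup_valUniformSpace : @IsUniformAddGroup A (valUniformSpace w) _ :=
  (Valued.mk' (AddValuation.toValuation w)).toIsUniformAddGroup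

theorem hasBasis_nhds_zero_valUniformSpace {π : A} (hπ : w π = ((1 : ℝ) : WithTop ℝ)) :
    (@nhds A (valUniformSpace w).toTopologicalSpace 0).HasBasis (fun _ : ℕ => True)
      fun n => {x | ((n : ℝ) : WithTop ℝ) ≤ w x} := by
  let : Valued A (Multiplicative (WithTop ℝ)ᵒᵈ) := Valued.mk' (AddValuation.toValuation w)
  have hv (x : A) : (Valued.v x : Multiplicative (WithTop ℝ)ᵒᵈ) = .ofAdd (.toDual (w x)) := rfl
  refine (Valued.hasBasis_nhds_zero A (Multiplicative (WithTop ℝ)ᵒᵈ)).to_hasBasis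
    (fun γ _ => ?_) fun n _ => ?_
  · obtain ⟨g, hg⟩ : ∃ g : WithTop ℝ,
        MonoidWithZeroHom.ValueGroup₀.embedding γ.1 = Multiplicative.ofAdd (OrderDual.toDual g) :=
      ⟨_, rfl⟩
    have hg_ne_top : g ≠ ⊤ := by
      rintro rfl
      exact (map_ne_zero MonoidWithZeroHom.ValueGroup₀.embedding).2 γ.ne_zero hg
    obtain ⟨C, rfl⟩ := WithTop.ne_top_iff_exists.1 hg_ne_top
    obtain ⟨n, hn⟩ := exists_nat_gt C
    refine ⟨n, trivial, fun x hx => ?_⟩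
    rw [mem_ofPred_eq, Valuation.restrict_lt_iff_lt_embedding, hg, hv]
    exact (WithTop.coe_lt_coe.2 hn).trans_le (show ((n : ℝ) : WithTop ℝ) ≤ w x from hx)
  · have hπn : w (π ^ n) = ((n : ℝ) : WithTop ℝ) := by
      rw [AddValuation.map_pow, hπ, ← WithTop.coe_nsmul, nsmul_one]
    have hne : Valued.v.restrict (π ^ n) ≠ 0 := by
      rw [Ne, Valuation.restrict_eq_zero_iff, hv, hπn]
      exact fun h => WithTop.coe_ne_top (congrArg (fun x => OrderDual.ofDual x.toAdd) h)
    refine ⟨Units.mk0 _ hne, trivial, fun x hx => ?_⟩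
    rw [mem_ofPred_eq, Units.val_mk0, Valuation.restrict_lt_iff, hv, hv, hπn] at hx
    exact le_of_lt (show ((n : ℝ) : WithTop ℝ) < w x from hx)

end ValUniformSpace

theorem valUniformSpace_wVal_eq_natural :
    (valUniformSpace (wVal p)).toTopologicalSpace =
      (inferInstance : TopologicalSpace (UnifMeasure p)) := by
  have huniform := isUniformAddGroup_valUniformSpace (wVal p)
  refine IsTopologicalAddGroup.ext ?_ inferInstance ?_
  · exact @IsUniformAddGroup.to_topologicalAddGroup _ (valUniformSpace (wVal p)) _ huniform
  · exact (hasBasis_nhds_zero_valUniformSpace (wVal p) wFun_p).eq_of_same_basis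
      hasBasis_nhds_zero_wVal

theorem tPow_sFrac_zero (n : ℕ) : tPow (sFrac p 0 n) = tT p 0 ^ n := tPow_sFrac 0 n

theorem wFun_tT_zero : wFun (tT p 0) = ((1 : ℝ) : WithTop ℝ) := by
  simpa [tPow_sFrac_zero, coe_sFrac] using wFun_tPow (sFrac p 0 1)

theorem weight_sFrac_zero_add (n : ℕ) (a : ℤ_[p]) (q : S p) :
    weight a (sFrac p 0 n + q) = ((n : ℝ) : WithTop ℝ) + weight a q := by
  simpa [weight_of_ne_zero, coe_sFrac] using weight_mul 1 a (sFrac p 0 n) q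

theorem le_wFun_of_mem_span_pow {n : ℕ} {μ : UnifMeasure p}
    (hμ : μ ∈ Ideal.span {(p : UnifMeasure p), tT p 0} ^ n) :
    ((n : ℝ) : WithTop ℝ) ≤ wFun μ := by
  rw [le_wFun_iff]
  induction n generalizing μ with
  | zero =>
    rw [Nat.cast_zero, weightClosure_zero]
    exact Submodule.mem_top
  | succ n ih =>
    rw [pow_succ] at hμ
    refine Submodule.mul_induction_on hμ (fun x hx y hy => ?_) fun _ _ => add_mem
    obtain ⟨r, s, rfl⟩ := Ideal.mem_span_pair.1 hy
    rw [Nat.cast_succ]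
    refine mul_mem_weightClosure (ih hx) (add_mem ?_ ?_)
    · exact mul_comm r _ ▸ mul_mem_weightClosure_right (le_wFun_iff.1 wFun_p.ge) r
    · exact mul_comm s _ ▸ mul_mem_weightClosure_right (le_wFun_iff.1 wFun_tT_zero.ge) s

theorem p_pow_dvd_sum_of_forall_dvd {n : ℕ} {a : S p → ℤ_[p]} {μ : UnifMeasure p}
    (hsum : HasSum (fun q => a q • tPow q) μ) (hdvd : ∀ q, (p : ℤ_[p]) ^ n ∣ a q) :
    (p : UnifMeasure p) ^ n ∣ μ :=
  p_pow_dvd_iff.2 fun h => hasSum_mem_of_isClosed (isClosed_nbhdIdeal h n)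
    (fun q => smul_mem_nbhdIdeal (hdvd q) h _) hsum

theorem tT_pow_dvd_of_hasSum {n : ℕ} {a : S p → ℤ_[p]} {μ : UnifMeasure p}
    (ha : WeightsTendToTop a) (hsum : HasSum (fun q => a q • tPow q) μ)
    (hzero : ∀ q : S p, (q : ℝ) < n → a q = 0) : tT p 0 ^ n ∣ μ := by
  have hinj : Function.Injective (sFrac p 0 n + ·) := add_right_injective _
  have hshift : WeightsTendToTop fun q => a (sFrac p 0 n + q) := fun C hC => by
    filter_upwards [hinj.tendsto_cofinite.eventually (ha (n + C) (by positivity))] with q hq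
    rw [weight_sFrac_zero_add, WithTop.coe_add] at hq
    exact lt_of_add_lt_add_left hq
  refine ⟨∑' q, a (sFrac p 0 n + q) • tPow q, hsum.unique ((hinj.hasSum_iff fun q hq => ?_).1 ?_)⟩
  · rw [hzero q, zero_smul]
    by_contra! hn
    obtain ⟨s, rfl⟩ := exists_add_eq (r := sFrac p 0 n) (q := q) (by simpa [coe_sFrac] using hn)
    exact hq ⟨s, rfl⟩
  · convert! hshift.summable.hasSum.mul_left (tT p 0 ^ n) using 2 with q
    rw [Function.comp_apply, tPow_add, tPow_sFrac_zero, mul_smul_comm]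

theorem mem_span_pow_of_le_wFun {n : ℕ} {μ : UnifMeasure p}
    (hμ : ((2 * n : ℝ) : WithTop ℝ) ≤ wFun μ) :
    μ ∈ Ideal.span {(p : UnifMeasure p), tT p 0} ^ n := by
  obtain ⟨a, ha, hsum⟩ := exists_series μ
  let s : Set (S p) := {q | (q : ℝ) < n}
  have hlow := (ha.indicator s).summable.hasSum
  have hhigh := (ha.indicator sᶜ).summable.hasSum
  have hμ_eq : μ = ∑' q, s.indicator a q • tPow q + ∑' q, sᶜ.indicator a q • tPow q :=
    hsum.unique (by simpa only [← add_smul, indicator_self_add_compl_apply] using hlow.add hhigh)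
  have hp_dvd (q : S p) : (p : ℤ_[p]) ^ n ∣ s.indicator a q := by
    refine dvd_indicator (fun q hq => (pow_dvd_pow _ ?_).trans
      (le_weight_iff.1 (hμ.trans ((isLeast_wFun ha hsum).2 ⟨q, rfl⟩)))) q
    have hn : (n : ℝ) ≤ 2 * n - q := by linarith [show (q : ℝ) < n from hq]
    exact_mod_cast hn.trans (Nat.le_ceil _)
  rw [hμ_eq]
  refine add_mem ?_ ?_
  · exact Ideal.mem_of_dvd _ (p_pow_dvd_sum_of_forall_dvd hlow hp_dvd)
      (Ideal.pow_mem_pow (Ideal.subset_span (by simp)) n)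
  · exact Ideal.mem_of_dvd _ (tT_pow_dvd_of_hasSum (ha.indicator sᶜ) hhigh fun q hq =>
      indicator_of_notMem (s := sᶜ) (not_not.2 hq) a)
      (Ideal.pow_mem_pow (Ideal.subset_span (by simp)) n)

theorem adicTopology_eq_natural :
    (Ideal.span {(p : UnifMeasure p), tT p 0}).adicTopology =
      (inferInstance : TopologicalSpace (UnifMeasure p)) := by
  refine Eq.symm (isAdic_iff.2 ⟨fun n => ?_, fun s hs => ?_⟩)
  · refine AddSubgroup.isOpen_of_mem_nhds
      (Ideal.span {(p : UnifMeasure p), tT p 0} ^ n).toAddSubgroup (g := 0) ?_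
    refine hasBasis_nhds_zero_wVal.mem_iff.2 ⟨2 * n, trivial, fun x hx => ?_⟩
    exact mem_span_pow_of_le_wFun (by simpa [wVal] using hx)
  · obtain ⟨n, -, hn⟩ := hasBasis_nhds_zero_wVal.mem_iff.1 hs
    exact ⟨n, fun x hx => hn (le_wFun_of_mem_span_pow hx)⟩

end Topologies

section Polynomials

theorem tPow_mem_ZT (q : S p) : tPow q ∈ ZT p :=
  pow_mem (Subring.subset_closure (mem_range_self _)) _

theorem exists_finsupp_of_mem_ZT {x : UnifMeasure p} (hx : x ∈ ZT p) :
    ∃ a : S p →₀ ℤ, x = a.sum fun q n => n • tPow q := by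
  have hle : ZT p ≤ (AddMonoidAlgebra.lift ℤ _ _ (tPowHom p)).toRingHom.range := by
    refine Subring.closure_le.2 ?_
    rintro _ ⟨n, rfl⟩
    refine ⟨AddMonoidAlgebra.single (sFrac p n 1) 1,
      (AddMonoidAlgebra.lift_single (tPowHom p) _ _).trans ?_⟩
    rw [one_smul]
    exact (tPow_sFrac n 1).trans (pow_one _)
  obtain ⟨f, rfl⟩ := hle hx
  exact ⟨f.coeff, AddMonoidAlgebra.lift_apply _ _⟩

theorem weightsTendToTop_intCast (a : S p →₀ ℤ) :
    WeightsTendToTop fun q => ((a q : ℤ) : ℤ_[p]) :=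
  weightsTendToTop_finsupp (a.mapRange Int.cast Int.cast_zero)

theorem hasSum_intCast (a : S p →₀ ℤ) :
    HasSum (fun q => ((a q : ℤ) : ℤ_[p]) • tPow q) (a.sum fun q n => n • tPow q) := by
  simp only [Int.cast_smul_eq_zsmul]
  exact hasSum_sum_of_ne_finset_zero fun q hq => by
    rw [Finsupp.notMem_support_iff.1 hq, zero_smul]

theorem existsUnique_finsupp (x : ZT p) :
    ∃! a : S p →₀ ℤ, (x : UnifMeasure p) = a.sum fun q n => n • tPow q := by
  obtain ⟨a, ha⟩ := exists_finsupp_of_mem_ZT x.2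
  refine ⟨a, ha, fun b hb => Finsupp.ext fun q => ?_⟩
  have hcoeff := series_unique (weightsTendToTop_intCast b) (weightsTendToTop_intCast a)
    (hasSum_intCast b) (by rw [← hb, ha]; exact hasSum_intCast a)
  exact Int.cast_injective (congrFun hcoeff q)

/-- The restriction of the valuation `w` to `ℤ[T̃ ^ (1 / p ^ ∞)]`. -/
def wValZT (p : ℕ) [Fact p.Prime] : AddValuation (ZT p) (WithTop ℝ) :=
  (wVal p).comap (ZT p).subtype

theorem isLeast_wValZT {x : ZT p} {a : S p →₀ ℤ}
    (hx : (x : UnifMeasure p) = a.sum fun q n => n • tPow q) :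
    IsLeast (range fun q : S p => weight (a q : ℤ_[p]) q) (wValZT p x) :=
  isLeast_wFun (weightsTendToTop_intCast a) (hx.symm ▸ hasSum_intCast a :)

theorem smul_tPow_mem_topologicalClosure_ZT (a : ℤ_[p]) (q : S p) :
    a • tPow q ∈ (ZT p).topologicalClosure := by
  refine PadicInt.denseRange_natCast.induction_on a
    ((ZT p).isClosed_topologicalClosure.preimage (continuous_id.smul continuous_const))
    fun m => (ZT p).le_topologicalClosure ?_
  rw [Nat.cast_smul_eq_nsmul]
  exact nsmul_mem (tPow_mem_ZT q) m

theorem topologicalClosure_ZT : (ZT p).topologicalClosure = ⊤ :=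
  (Subring.eq_top_iff' _).2 fun μ =>
    let ⟨_, _, hsum⟩ := exists_series μ
    hasSum_mem_of_isClosed (ZT p).isClosed_topologicalClosure
      (fun _ => smul_tPow_mem_topologicalClosure_ZT _ _) hsum

theorem isUniformInducing_subtype_ZT :
    @IsUniformInducing _ _ (valUniformSpace (wValZT p)) _ (ZT p).subtype := by
  have huniform := isUniformAddGroup_valUniformSpace (wValZT p)
  refine @IsUniformInducing.mk _ _ (valUniformSpace (wValZT p)) _ _ ?_
  rw [uniformity_eq_comap_nhds_zero (UnifMeasure p),
    @uniformity_eq_comap_nhds_zero _ (valUniformSpace (wValZT p)), comap_comap]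
  exact (hasBasis_nhds_zero_wVal.comap _).eq_of_same_basis
    ((hasBasis_nhds_zero_valUniformSpace (wValZT p) (π := (p : ZT p)) wFun_p).comap _)

theorem isValuationCompletion_wValZT : IsValuationCompletion (wValZT p) (ZT p).subtype where
  isTopologicalRing := inferInstance
  isUniformAddGroup := inferInstance
  completeSpace := inferInstance
  t2Space := inferInstance
  isUniformInducing := isUniformInducing_subtype_ZT
  denseRange := by
    have hrange : range (ZT p).subtype = (ZT p : Set (UnifMeasure p)) := Subtype.range_coe
    rw [DenseRange, dense_iff_closure_eq, hrange]
    exact congrArg SetLike.coe topologicalClosure_ZT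

end Polynomials

end PadicMeasures

end

theorem corollary8p5 (p : ℕ) [Fact p.Prime] :
    -- `T̃_n` is the `p`-adic limit of `T_{n+m} ^ (p ^ m)`, and `T̃ ^ (m / p ^ n) = T̃_n ^ m`
    (∀ n : ℕ, Filter.Tendsto (fun m : ℕ => T p (n + m) ^ p ^ m) Filter.atTop
      (@nhds _ (pAdicTopology p) (tT p n))) ∧
    (∀ (m n : ℕ) (q : S p), (q : ℝ) = m / (p : ℝ) ^ n → tPow q = tT p n ^ m) ∧
    -- the ring of uniform measures is the `w`-completion of `ℤ[T̃ ^ (1 / p ^ ∞)]`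
    (∀ x : ZT p, ∃! a : S p →₀ ℤ, (x : UnifMeasure p) = a.sum fun q n => n • tPow q) ∧
    (∃ w₀ : AddValuation (ZT p) (WithTop ℝ),
      (∀ (x : ZT p) (a : S p →₀ ℤ), ((x : UnifMeasure p) = a.sum fun q n => n • tPow q) →
        IsLeast (Set.range fun q : S p => weight (a q : ℤ_[p]) q) (w₀ x)) ∧
      IsValuationCompletion w₀ (ZT p).subtype) ∧
    -- expansions in `S`-series
    (∀ μ : UnifMeasure p, ∃! a : S p → ℤ_[p],
      WeightsTendToTop a ∧ HasSum (fun q => a q • tPow q) μ) ∧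
    (∀ a : S p → ℤ_[p], WeightsTendToTop a → Summable fun q => a q • tPow q) ∧
    -- the valuation `w` induces the `(p, T̃)`-adic topology, which is also the natural one
    (∃ w : AddValuation (UnifMeasure p) (WithTop ℝ),
      (∀ (μ : UnifMeasure p) (a : S p → ℤ_[p]), WeightsTendToTop a →
        HasSum (fun q => a q • tPow q) μ →
          IsLeast (Set.range fun q : S p => weight (a q) q) (w μ)) ∧
      (Ideal.span {(p : UnifMeasure p), tT p 0}).adicTopology =
        (valUniformSpace w).toTopologicalSpace ∧
      (valUniformSpace w).toTopologicalSpace =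
        (inferInstance : TopologicalSpace (UnifMeasure p))) :=
  ⟨tendsto_tT, tPow_eq, existsUnique_finsupp,
    ⟨wValZT p, fun _ _ hx => isLeast_wValZT hx, isValuationCompletion_wValZT⟩,
    existsUnique_series, fun _ ha => ha.summable,
    ⟨wVal p, fun _ _ ha hsum => isLeast_wFun ha hsum,
      adicTopology_eq_natural.trans valUniformSpace_wVal_eq_natural.symm,
      valUniformSpace_wVal_eq_natural⟩⟩
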